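/- **Setting.** Let $\Gamma$ be a connected compact quantum graph: finitely many vertices $v\in V$, a finite non-empty set $E$ of edges $e$ (loops and multiple edges are allowed), each identified with a segment $[0,L_e]$, $L_e>0$, and a parameter $\alpha_v\in\mathbb R\cup\{\infty\}$ at every vertex. Let $H=-\frac{d^2}{dx^2}$ be the Hamiltonian of $\Gamma$ on $L^2(\Gamma)=\bigoplus_e L^2(0,L_e)$, with domain the functions $f\in\bigoplus_e H^2(0,L_e)$ that are continuous at the vertices and satisfy, at every vertex $v$, $\sum f'(v)=\alpha_v f(v)$, where the sum is over all edge ends at $v$ and derivatives are taken into the edge ($\alpha_v=\infty$ means $f(v)=0$). Let $\sigma(\Gamma)$ be the spectrum of $H$. Choose a set $\mathcal M$ of $M$ vertices (the marked vertices). Let $\sigma(\Gamma^*)$ be the set of eigenvalues of the restriction of $H$ to the functions of its domain that in addition vanish at all marked vertices. Attach one infinite lead to every marked vertex, keeping all the $\alpha_v$, and let $d_v$ be the number of edge ends and leads at $v$ in the extended graph. For real $k\neq0$ let $\Sigma(k)$ be the matrix, indexed by the $M$ leads and the $2|E|$ edge ends, with entries $$\Sigma(k)_{ij}=\frac{2}{d_v+i\alpha_v/k}-\delta_{ij}$$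 if $i,j$ are attached to the same vertex $v$ (the fraction being $0$ if $\alpha_v=\infty$), and $\Sigma(k)_{ij}=0$ otherwise. Let $J_o$ be the permutation matrix that swaps the two ends of every edge and fixes the leads, let $L_o$ be the diagonal matrix with entry $L_e$ at both ends of $e$ and $0$ at the leads, and put $$Q(k)=e^{ikL_o}J_o\Sigma(k)=\begin{pmatrix}R&T_o\\T_i&\tilde U\end{pmatrix},$$ with the blocks taken with respect to leads and edge ends. A matrix $S$ is called a scattering matrix at $k$ if $S=R+T_oC$ for some $C$ with $(I-\tilde U)C=T_i$. Finally let $$\Delta=\{k\in\mathbb R\setminus\{0\} : \det(I-\tilde U(k))=0\}.$$ **Proposition (inside–outside duality).** For every real $k\ne0$ there is exactly one scattering matrix $S(k)$, and $$\{k\in\mathbb R\setminus\{0\} : k^2\in\sigma(\Gamma)\}=\Delta\cup\{k\in\mathbb R\setminus\{0\} : \det(I-S(k))=0\}.$$ Moreover $\Delta=\{k\in\mathbb R\setminus\{0\} : k^2\in\sigma(\Gamma^*)\}$. -/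

import Mathlib

open MeasureTheory

/-- A finite compact metric graph with vertex set `V` and edge set `E` (multiple edges and loops
are allowed), carrying at every vertex an extended `δ`-type condition.
The edge `e` is the segment `[0, length e]`; its end `x = 0` is glued to the vertex
`endpt e false` and its end `x = length e` is glued to the vertex `endpt e true`.
The value `α v = ⊤` means the Dirichlet condition at `v`. -/
structure QuantumGraph (V E : Type*) where
  endpt : E → Bool → V
  length : E → ℝ
  length_pos : ∀ e, 0 < length e
  α : V → WithTop ℝ

namespace QuantumGraph

/-- The underlying (combinatorial) graph is connected. -/
def Connected {V E : Type*} (Γ : QuantumGraph V E) : Prop :=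
  (SimpleGraph.fromRel fun u v : V => ∃ e, Γ.endpt e false = u ∧ Γ.endpt e true = v).Connected

/-! ### The Hamiltonian -/

/-- `f` is (the `C¹` representative of) an element of the Sobolev space `H²(0, ℓ)`, with
derivative `f'` and second derivative `f''`: on `[0, ℓ]` the functions `f` and `f'` are the
indefinite integrals of `f'` and `f''`, and `f''` is square integrable. -/
structure IsH2 (ℓ : ℝ) (f f' f'' : ℝ → ℂ) : Prop where
  memLp : MemLp f'' 2 (volume.restrict (Set.Ioc 0 ℓ))
  eq_integral : ∀ x ∈ Set.Icc 0 ℓ, f x = f 0 + ∫ t in (0 : ℝ)..x, f' t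
  deriv_eq_integral : ∀ x ∈ Set.Icc 0 ℓ, f' x = f' 0 + ∫ t in (0 : ℝ)..x, f'' t

/-- The Hilbert space `L²(Γ) = ⨁ₑ L²(0, length e)`. -/
abbrev L2 {V E : Type*} [Fintype E] (Γ : QuantumGraph V E) : Type _ :=
  PiLp 2 fun e : E => Lp ℂ 2 (volume.restrict (Set.Ioc 0 (Γ.length e)))

/-- The value of `f` at the end `(e, s)` of the edge `e`. -/
def endValue {V E : Type*} (Γ : QuantumGraph V E) (f : E → ℝ → ℂ) (h : E × Bool) : ℂ :=
  if h.2 then f h.1 (Γ.length h.1) else f h.1 0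

/-- The derivative at the end `(e, s)` of the edge `e`, taken into the edge and away from the
vertex, where `f'` is the derivative in the coordinate `x ∈ [0, length e]`. -/
def endDeriv {V E : Type*} (Γ : QuantumGraph V E) (f' : E → ℝ → ℂ) (h : E × Bool) : ℂ :=
  if h.2 then -f' h.1 (Γ.length h.1) else f' h.1 0

/-- The `δ`-type condition at the vertex `v` for a function with the value `y` at `v` and with
the sum `y'` of the derivatives at `v`. -/
def DeltaCondition {V E : Type*} (Γ : QuantumGraph V E) (v : V) (y y' : ℂ) : Prop :=
  match Γ.α v with
  | ⊤ => y = 0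
  | (a : ℝ) => y' = a * y

/-- `f`, with derivative `f'`, is continuous at the vertices, satisfies the `δ`-type condition
at every vertex, and in addition vanishes at the vertices in `D`. -/
def VertexConditions {V E : Type*} [DecidableEq V] [Fintype E] (Γ : QuantumGraph V E)
    (D : Finset V) (f f' : E → ℝ → ℂ) : Prop :=
  ∃ φ : V → ℂ,
    (∀ h : E × Bool, Γ.endValue f h = φ (Γ.endpt h.1 h.2)) ∧
    (∀ v, Γ.DeltaCondition v (φ v)
      (∑ h : E × Bool with Γ.endpt h.1 h.2 = v, Γ.endDeriv f' h)) ∧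
    ∀ v ∈ D, φ v = 0

/-- `u` lies in the domain of the operator `H : f ↦ -f''` on `L²(Γ)` with the vertex conditions
of `Γ` and the additional conditions `f v = 0` for `v ∈ D`, and `H u = w`. For `D = ∅` this is
the graph of the Hamiltonian of `Γ`; for the set `D` of marked vertices it is the graph of the
Hamiltonian of `Γ*`. -/
def HamiltonianEq {V E : Type*} [DecidableEq V] [Fintype E] (Γ : QuantumGraph V E)
    (D : Finset V) (u w : Γ.L2) : Prop :=
  ∃ f f' f'' : E → ℝ → ℂ,
    (∀ e, IsH2 (Γ.length e) (f e) (f' e) (f'' e)) ∧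
    Γ.VertexConditions D f f' ∧
    (∀ e, u e =ᵐ[volume.restrict (Set.Ioc 0 (Γ.length e))] f e) ∧
    (∀ e, w e =ᵐ[volume.restrict (Set.Ioc 0 (Γ.length e))] fun x => -f'' e x)

/-- `lam` is in the resolvent set of the Hamiltonian `H` of `Γ`: there is a bounded operator `R`
on `L²(Γ)` which is a two-sided inverse of `H - lam`, that is, `u ∈ dom H` and
`(H - lam) u = g` if and only if `u = R g`. -/
def InResolventSet {V E : Type*} [DecidableEq V] [Fintype E] (Γ : QuantumGraph V E)
    (lam : ℂ) : Prop :=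
  ∃ R : Γ.L2 →L[ℂ] Γ.L2, ∀ u g : Γ.L2, Γ.HamiltonianEq ∅ u (g + lam • u) ↔ u = R g

/-- The spectrum `σ(Γ)` of the Hamiltonian of `Γ`. -/
def spectrum {V E : Type*} [DecidableEq V] [Fintype E] (Γ : QuantumGraph V E) : Set ℂ :=
  {lam | ¬ Γ.InResolventSet lam}

/-- The set `σ(Γ*)` of eigenvalues of the operator `-d²/dx²` on `Γ` with the additional
conditions `f v = 0` at the marked vertices `v ∈ M`. (This operator is symmetric but in general
not self-adjoint.) -/
def starSpectrum {V E : Type*} [DecidableEq V] [Fintype E] (Γ : QuantumGraph V E)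
    (M : Finset V) : Set ℂ :=
  {lam | ∃ u : Γ.L2, u ≠ 0 ∧ Γ.HamiltonianEq M u (lam • u)}

/-! ### The graph with leads and its scattering matrix -/

/-- Index set of the amplitudes on the graph `Γ̃` obtained from `Γ` by attaching one infinite lead
to every marked vertex `v ∈ M`: one index for each lead and two indices, the ends `(e, false)`
and `(e, true)`, for each edge `e`. -/
abbrev Ends {V : Type*} (E : Type*) (M : Finset V) : Type _ := {v // v ∈ M} ⊕ (E × Bool)

/-- The vertex at which an edge end or a lead is attached. -/
def vertexOf {V E : Type*} (Γ : QuantumGraph V E) (M : Finset V) : Ends E M → V :=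
  Sum.elim (fun l => l.1) (fun h => Γ.endpt h.1 h.2)

/-- The degree of `v` in `Γ̃` (the lead is counted, and a loop counts twice). -/
def extDegree {V E : Type*} [DecidableEq V] [Fintype E] (Γ : QuantumGraph V E)
    (M : Finset V) (v : V) : ℕ :=
  (Finset.univ.filter fun i : Ends E M => Γ.vertexOf M i = v).card

/-- The number `2 / (d_v + i α_v / k)`, which is `0` for `α_v = ∞`. -/
noncomputable def vertexCoupling {V E : Type*} [DecidableEq V] [Fintype E]
    (Γ : QuantumGraph V E) (M : Finset V) (k : ℝ) (v : V) : ℂ :=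
  match Γ.α v with
  | ⊤ => 0
  | (a : ℝ) => 2 / (Γ.extDegree M v + Complex.I * a / k)

/-- The matrix `Σ(k)` of `Γ̃`, composed of the vertex-scattering matrices
`σ⁽ᵛ⁾ᵢⱼ = 2 / (d_v + i α_v / k) - δᵢⱼ`. -/
noncomputable def vertexScattering {V E : Type*} [DecidableEq V] [Fintype E] [DecidableEq E]
    (Γ : QuantumGraph V E) (M : Finset V) (k : ℝ) : Matrix (Ends E M) (Ends E M) ℂ :=
  Matrix.of fun i j =>
    if Γ.vertexOf M i = Γ.vertexOf M j then
      Γ.vertexCoupling M k (Γ.vertexOf M i) - (if i = j then 1 else 0)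
    else 0

/-- The diagonal of `L_o`: every edge length appears twice, and every lead contributes `0`. -/
def extLength {V E : Type*} (Γ : QuantumGraph V E) (M : Finset V) : Ends E M → ℝ :=
  Sum.elim (fun _ => 0) (fun h => Γ.length h.1)

/-- The involution of the index set which swaps the two ends of every edge and fixes the leads. -/
def flipEnds {V E : Type*} (M : Finset V) : Ends E M → Ends E M :=
  Sum.map id (fun h => (h.1, !h.2))

/-- The permutation matrix `J_o` of `flipEnds`. -/
def flipMatrix {V : Type*} (E : Type*) [DecidableEq V] [DecidableEq E] (M : Finset V) :
    Matrix (Ends E M) (Ends E M) ℂ :=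
  Matrix.of fun i j => if flipEnds M i = j then 1 else 0

/-- The matrix `Q(k) = e^{i k L_o} J_o Σ(k)`, so that the amplitudes of the solutions on `Γ̃` are
given by `(c^out, a) = Q(k) (c^in, a)`. -/
noncomputable def evolution {V E : Type*} [DecidableEq V] [Fintype E] [DecidableEq E]
    (Γ : QuantumGraph V E) (M : Finset V) (k : ℝ) : Matrix (Ends E M) (Ends E M) ℂ :=
  Matrix.diagonal (fun i => Complex.exp (Complex.I * k * Γ.extLength M i)) *
    flipMatrix E M * Γ.vertexScattering M k

/-- The block `R(k)` of `Q(k)` (leads to leads). -/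
noncomputable def matR {V E : Type*} [DecidableEq V] [Fintype E] [DecidableEq E]
    (Γ : QuantumGraph V E) (M : Finset V) (k : ℝ) : Matrix {v // v ∈ M} {v // v ∈ M} ℂ :=
  (Γ.evolution M k).toBlocks₁₁

/-- The block `T_o(k)` of `Q(k)` (edges to leads). -/
noncomputable def matTo {V E : Type*} [DecidableEq V] [Fintype E] [DecidableEq E]
    (Γ : QuantumGraph V E) (M : Finset V) (k : ℝ) : Matrix {v // v ∈ M} (E × Bool) ℂ :=
  (Γ.evolution M k).toBlocks₁₂

/-- The block `T_i(k)` of `Q(k)` (leads to edges). -/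
noncomputable def matTi {V E : Type*} [DecidableEq V] [Fintype E] [DecidableEq E]
    (Γ : QuantumGraph V E) (M : Finset V) (k : ℝ) : Matrix (E × Bool) {v // v ∈ M} ℂ :=
  (Γ.evolution M k).toBlocks₂₁

/-- The block `Ũ(k)` of `Q(k)` (edges to edges). -/
noncomputable def matU {V E : Type*} [DecidableEq V] [Fintype E] [DecidableEq E]
    (Γ : QuantumGraph V E) (M : Finset V) (k : ℝ) : Matrix (E × Bool) (E × Bool) ℂ :=
  (Γ.evolution M k).toBlocks₂₂

/-- `S` is a scattering matrix of `Γ̃` at `k`: `S = R + T_o C` for a solution `C` of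
`(1 - Ũ) C = T_i`. -/
def IsScatteringMatrix {V E : Type*} [DecidableEq V] [Fintype E] [DecidableEq E]
    (Γ : QuantumGraph V E) (M : Finset V) (k : ℝ) (S : Matrix {v // v ∈ M} {v // v ∈ M} ℂ) :
    Prop :=
  ∃ C : Matrix (E × Bool) {v // v ∈ M} ℂ,
    (1 - Γ.matU M k) * C = Γ.matTi M k ∧ S = Γ.matR M k + Γ.matTo M k * C

/-- The set `Δ` of the nonzero real `k` for which `1 - Ũ(k)` is singular. -/
def Delta {V E : Type*} [DecidableEq V] [Fintype E] [DecidableEq E]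
    (Γ : QuantumGraph V E) (M : Finset V) : Set ℝ :=
  {k | k ≠ 0 ∧ (1 - Γ.matU M k).det = 0}

end QuantumGraph

/-!
A function on `Γ` with `-f'' = k² f` is on every edge a superposition of two plane waves, hence is
given by the amplitudes `a` of the waves arriving at the edge ends. Together with amplitudes `c` of
incoming waves on the leads, the equation `Q(k) (c, a) = (c', a)` expresses exactly that the
function is continuous and satisfies the `δ`-type conditions of the extended graph
(`evolution_mulVec_inr_eq_iff`). Two cases matter.

* If `c' = c`, the function is stationary on each lead at its vertex, so the lead contributes
  nothing to the sum of derivatives and `f` satisfies the vertex conditions of `Γ`; conversely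
  `c v = f(v) / 2`. So `k²` is an eigenvalue of `H` if and only if `det (1 - Q(k)) = 0`
  (`det_one_sub_evolution_eq_zero_iff`).
* If `c = 0` and `Ũ(k) a = a`, unitarity of `Q(k)` forces `c' = 0`, so `f` vanishes at the marked
  vertices; conversely such an `f` gives `Ũ(k) a = a` (`det_one_sub_matU_eq_zero_iff`). This is the
  description of `Δ` by `σ(Γ*)`.

For a unitary block matrix `Q`, the fixed vectors of the inner block `Ũ` are annihilated by `T_o`,
and the columns of `T_i` lie in the range of `1 - Ũ`. This gives existence and uniqueness of the
scattering matrix `S` and the equivalence of `det (1 - Q) = 0` with `det (1 - Ũ) = 0` or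
`det (1 - S) = 0` (`Matrix.det_one_sub_eq_zero_iff_toBlocks`).

The spectrum is defined through bounded resolvents, so one also needs that `k²` is in the resolvent
set unless it is an eigenvalue (`inResolventSet_of_forall_wave`): a particular solution on every
edge, bounded in terms of the right-hand side, is corrected by plane waves whose amplitudes solve a
square linear system, and this system is injective, hence invertible, when `k²` is not an
eigenvalue.
-/

/-! ### Unitary block matrices -/

namespace Matrix

open scoped ComplexOrder

variable {m n : Type*}

theorem star_sum_elim (a : m → ℂ) (c : n → ℂ) :
    star (Sum.elim a c) = Sum.elim (star a) (star c) := by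
  ext i; cases i <;> rfl

variable [Fintype m] [Fintype n]

theorem elim_dotProduct_elim (a b : m → ℂ) (c d : n → ℂ) :
    Sum.elim a c ⬝ᵥ Sum.elim b d = a ⬝ᵥ b + c ⬝ᵥ d := by
  simp [dotProduct]

theorem mulVec_sum_elim (Q : Matrix (m ⊕ n) (m ⊕ n) ℂ) (c : m → ℂ) (a : n → ℂ) :
    Q *ᵥ Sum.elim c a =
      Sum.elim (Q.toBlocks₁₁ *ᵥ c + Q.toBlocks₁₂ *ᵥ a) (Q.toBlocks₂₁ *ᵥ c + Q.toBlocks₂₂ *ᵥ a) := by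
  conv_lhs => rw [← fromBlocks_toBlocks Q, fromBlocks_mulVec]
  simp

variable [DecidableEq m] [DecidableEq n]

theorem star_mulVec_dotProduct_mulVec_of_unitary {Q : Matrix n n ℂ} (hQ : Qᴴ * Q = 1)
    (z : n → ℂ) : star (Q *ᵥ z) ⬝ᵥ (Q *ᵥ z) = star z ⬝ᵥ z := by
  rw [star_mulVec, ← dotProduct_mulVec, mulVec_mulVec, hQ, one_mulVec]

/-- A vector fixed by the inner block of a unitary matrix has maximal norm there, so nothing of it
is left for the other block. -/
theorem toBlocks₁₂_mulVec_eq_zero {Q : Matrix (m ⊕ n) (m ⊕ n) ℂ} (hQ : Qᴴ * Q = 1) {a : n → ℂ}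
    (ha : Q.toBlocks₂₂ *ᵥ a = a) : Q.toBlocks₁₂ *ᵥ a = 0 := by
  have h := star_mulVec_dotProduct_mulVec_of_unitary hQ (Sum.elim 0 a)
  rw [mulVec_sum_elim, star_sum_elim, star_sum_elim, elim_dotProduct_elim,
    elim_dotProduct_elim] at h
  simp only [mulVec_zero, zero_add, ha, star_zero, dotProduct_zero] at h
  exact dotProduct_star_self_eq_zero.1 (by simpa using h)

theorem vecMul_toBlocks₂₁_eq_zero {Q : Matrix (m ⊕ n) (m ⊕ n) ℂ} (hQ : Qᴴ * Q = 1) {w : n → ℂ}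
    (hw : w ᵥ* Q.toBlocks₂₂ = w) : w ᵥ* Q.toBlocks₂₁ = 0 := by
  have hQ' : Qᵀᴴ * Qᵀ = 1 := by
    have h := congrArg Matrix.transpose (mul_eq_one_comm.1 hQ)
    rwa [transpose_mul, transpose_one] at h
  have h : Qᵀ.toBlocks₁₂ *ᵥ w = 0 := by
    refine toBlocks₁₂_mulVec_eq_zero hQ' ?_
    change Q.toBlocks₂₂ᵀ *ᵥ w = w
    rwa [mulVec_transpose]
  change Q.toBlocks₂₁ᵀ *ᵥ w = 0 at h
  rwa [mulVec_transpose] at h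

/-- `1 - Q₂₂` may be singular, but its range always contains the columns of `Q₂₁`: a functional
that annihilates the range is a row vector fixed by `Q₂₂`, which then annihilates `Q₂₁`. -/
theorem exists_one_sub_toBlocks₂₂_mul_eq {Q : Matrix (m ⊕ n) (m ⊕ n) ℂ} (hQ : Qᴴ * Q = 1) :
    ∃ C : Matrix n m ℂ, (1 - Q.toBlocks₂₂) * C = Q.toBlocks₂₁ := by
  have key : ∀ c : m, ∃ x : n → ℂ, (1 - Q.toBlocks₂₂) *ᵥ x = Q.toBlocks₂₁.col c := by
    intro c
    have : Q.toBlocks₂₁.col c ∈ LinearMap.range (mulVecLin (1 - Q.toBlocks₂₂)) := by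
      rw [← Subspace.forall_mem_dualAnnihilator_apply_eq_zero_iff]
      intro f hf
      obtain ⟨w, rfl⟩ := (dotProductEquiv ℂ n).surjective f
      rw [Submodule.mem_dualAnnihilator] at hf
      have hw : w ᵥ* (1 - Q.toBlocks₂₂) = 0 := by
        refine dotProduct_eq_zero_iff.1 fun x => ?_
        have := hf _ ⟨x, rfl⟩
        rwa [← dotProduct_mulVec]
      rw [vecMul_sub, vecMul_one, sub_eq_zero] at hw
      exact congrFun (vecMul_toBlocks₂₁_eq_zero hQ hw.symm) c
    obtain ⟨x, hx⟩ := this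
    exact ⟨x, hx⟩
  choose x hx using key
  refine ⟨Matrix.of fun i c => x c i, ?_⟩
  ext i c
  exact congrFun (hx c) i

theorem toBlocks₁₂_mulVec_eq_of_mulVec_eq {Q : Matrix (m ⊕ n) (m ⊕ n) ℂ} (hQ : Qᴴ * Q = 1)
    {a b : n → ℂ} (h : (1 - Q.toBlocks₂₂) *ᵥ a = (1 - Q.toBlocks₂₂) *ᵥ b) :
    Q.toBlocks₁₂ *ᵥ a = Q.toBlocks₁₂ *ᵥ b := by
  rw [← sub_eq_zero, ← mulVec_sub]
  rw [← sub_eq_zero, ← mulVec_sub, sub_mulVec, one_mulVec, sub_eq_zero] at h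
  exact toBlocks₁₂_mulVec_eq_zero hQ h.symm

theorem toBlocks₁₂_mul_eq_of_mul_eq {Q : Matrix (m ⊕ n) (m ⊕ n) ℂ} (hQ : Qᴴ * Q = 1)
    {C C' : Matrix n m ℂ} (h : (1 - Q.toBlocks₂₂) * C = (1 - Q.toBlocks₂₂) * C') :
    Q.toBlocks₁₂ * C = Q.toBlocks₁₂ * C' := by
  ext i c
  refine congrFun (toBlocks₁₂_mulVec_eq_of_mulVec_eq hQ (a := C.col c) (b := C'.col c) ?_) i
  ext j
  exact congrFun (congrFun h j) c

theorem det_one_sub_eq_zero_iff {A : Matrix n n ℂ} :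
    (1 - A).det = 0 ↔ ∃ a ≠ 0, A *ᵥ a = a := by
  rw [← exists_mulVec_eq_zero_iff]
  simp only [sub_mulVec, one_mulVec, sub_eq_zero, eq_comm]

/-- A unitary block matrix has the eigenvalue `1` if and only if its inner block
has, or the matrix `Q₁₁ + Q₁₂ C`, in which the inner indices are eliminated, has. -/
theorem det_one_sub_eq_zero_iff_toBlocks {Q : Matrix (m ⊕ n) (m ⊕ n) ℂ} (hQ : Qᴴ * Q = 1)
    {C : Matrix n m ℂ} (hC : (1 - Q.toBlocks₂₂) * C = Q.toBlocks₂₁) :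
    (1 - Q).det = 0 ↔
      (1 - Q.toBlocks₂₂).det = 0 ∨ (1 - (Q.toBlocks₁₁ + Q.toBlocks₁₂ * C)).det = 0 := by
  simp only [det_one_sub_eq_zero_iff]
  constructor
  · rintro ⟨z, hz, h⟩
    obtain ⟨c, a, rfl⟩ : ∃ c a, z = Sum.elim c a :=
      ⟨z ∘ Sum.inl, z ∘ Sum.inr, (Sum.elim_comp_inl_inr z).symm⟩
    rw [mulVec_sum_elim] at h
    have h₁ : Q.toBlocks₁₁ *ᵥ c + Q.toBlocks₁₂ *ᵥ a = c := funext fun i => congrFun h (Sum.inl i)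
    have h₂ : Q.toBlocks₂₁ *ᵥ c + Q.toBlocks₂₂ *ᵥ a = a := funext fun i => congrFun h (Sum.inr i)
    by_cases hc : c = 0
    · subst hc
      refine Or.inl ⟨a, ?_, by simpa using h₂⟩
      rintro rfl
      exact hz (by ext i; cases i <;> rfl)
    · refine Or.inr ⟨c, hc, ?_⟩
      have : Q.toBlocks₁₂ *ᵥ (C *ᵥ c) = Q.toBlocks₁₂ *ᵥ a := by
        refine toBlocks₁₂_mulVec_eq_of_mulVec_eq hQ ?_
        rw [mulVec_mulVec, hC, sub_mulVec, one_mulVec, eq_sub_iff_add_eq, h₂]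
      rw [add_mulVec, ← mulVec_mulVec, this, h₁]
  · rintro (⟨a, ha, h⟩ | ⟨c, hc, h⟩)
    · refine ⟨Sum.elim 0 a, fun h0 => ha (funext fun i => congrFun h0 (Sum.inr i)), ?_⟩
      rw [mulVec_sum_elim, toBlocks₁₂_mulVec_eq_zero hQ h, h]
      simp
    · refine ⟨Sum.elim c (C *ᵥ c), fun h0 => hc (funext fun i => congrFun h0 (Sum.inl i)), ?_⟩
      rw [mulVec_sum_elim]
      congr 1
      · rw [mulVec_mulVec, ← add_mulVec, h]
      · rw [← hC, ← mulVec_mulVec, sub_mulVec, one_mulVec, sub_add_cancel]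

end Matrix

namespace QuantumGraph

/-! ### Connectedness and unitarity of the evolution matrix -/

section Unitary

open Matrix

theorem flipEnds_flipEnds {V E : Type*} (M : Finset V) (i : Ends E M) :
    flipEnds M (flipEnds M i) = i := by
  rcases i with i | ⟨e, s⟩ <;> simp [flipEnds]

variable {V E : Type*} [DecidableEq V] (Γ : QuantumGraph V E)

/-- No vertex is isolated, even if there is only one vertex, because then every edge is a loop. -/
theorem exists_endpt_eq {V E : Type*} (Γ : QuantumGraph V E) [Nonempty E] (hΓ : Γ.Connected)
    (v : V) : ∃ h : E × Bool, Γ.endpt h.1 h.2 = v := by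
  by_cases hV : ∃ w : V, w ≠ v
  · obtain ⟨w, hw⟩ := hV
    have : Nontrivial V := ⟨⟨w, v, hw⟩⟩
    obtain ⟨u, hu⟩ := hΓ.preconnected.exists_adj_of_nontrivial v
    rw [SimpleGraph.fromRel_adj] at hu
    rcases hu.2 with ⟨e, he, -⟩ | ⟨e, -, he⟩
    · exact ⟨(e, false), he⟩
    · exact ⟨(e, true), he⟩
  · push Not at hV
    exact ⟨(Classical.arbitrary E, false), hV _⟩

variable [Fintype E] (M : Finset V) (k : ℝ)

theorem extDegree_pos [Nonempty E] (hΓ : Γ.Connected) (v : V) : 0 < Γ.extDegree M v := by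
  obtain ⟨h, hh⟩ := Γ.exists_endpt_eq hΓ v
  exact Finset.card_pos.2 ⟨Sum.inr h, Finset.mem_filter.2 ⟨Finset.mem_univ _, hh⟩⟩

theorem natCast_add_I_mul_div_ne_zero {d : ℕ} (hd : 0 < d) (a k : ℝ) :
    (d + Complex.I * a / k : ℂ) ≠ 0 := by
  intro h
  have := congrArg Complex.re h
  rw [mul_div_assoc, ← Complex.ofReal_div] at this
  simp at this
  omega

/-- The identity `d |τ|² = τ + τ̄` for the coupling constant `τ = 2 / (d + i α / k)`, which makes the
vertex-scattering matrices unitary. -/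
theorem extDegree_mul_normSq_vertexCoupling {v : V} (hv : 0 < Γ.extDegree M v) :
    (Γ.extDegree M v : ℂ) * (star (Γ.vertexCoupling M k v) * Γ.vertexCoupling M k v) =
      Γ.vertexCoupling M k v + star (Γ.vertexCoupling M k v) := by
  unfold vertexCoupling
  cases hα : Γ.α v with
  | top => simp
  | coe a =>
    simp only
    have h1 := natCast_add_I_mul_div_ne_zero hv a k
    have h2 : (Γ.extDegree M v - Complex.I * a / k : ℂ) ≠ 0 := by
      simpa [neg_div, sub_eq_add_neg] using natCast_add_I_mul_div_ne_zero hv (-a) k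
    have h3 : star (2 / (Γ.extDegree M v + Complex.I * a / k : ℂ)) =
        2 / (Γ.extDegree M v - Complex.I * a / k) := by
      simp [neg_div, sub_eq_add_neg]
    rw [h3]
    field_simp
    ring

/-- The matrix `Σ(k) + 1`, whose entry is the coupling constant of the common vertex. -/
noncomputable def couplingMatrix : Matrix (Ends E M) (Ends E M) ℂ :=
  Matrix.of fun i j =>
    if Γ.vertexOf M i = Γ.vertexOf M j then Γ.vertexCoupling M k (Γ.vertexOf M i) else 0

theorem couplingMatrix_conjTranspose_mul (hd : ∀ v, 0 < Γ.extDegree M v) :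
    (Γ.couplingMatrix M k)ᴴ * Γ.couplingMatrix M k =
      Γ.couplingMatrix M k + (Γ.couplingMatrix M k)ᴴ := by
  ext i j
  simp only [Matrix.mul_apply, Matrix.conjTranspose_apply, Matrix.add_apply]
  by_cases h : Γ.vertexOf M i = Γ.vertexOf M j
  · have : ∀ l, star (Γ.couplingMatrix M k l i) * Γ.couplingMatrix M k l j =
        if Γ.vertexOf M l = Γ.vertexOf M i then
          star (Γ.vertexCoupling M k (Γ.vertexOf M i)) * Γ.vertexCoupling M k (Γ.vertexOf M i)
        else 0 := by
      intro l
      simp only [couplingMatrix, Matrix.of_apply, ← h]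
      split_ifs with hl
      · rw [hl]
      · simp
    simp only [this, ← Finset.sum_filter, Finset.sum_const, nsmul_eq_mul]
    rw [← extDegree, Γ.extDegree_mul_normSq_vertexCoupling M k (hd _)]
    simp [couplingMatrix, h]
  · rw [Finset.sum_eq_zero]
    · simp [couplingMatrix, h, Ne.symm h]
    · intro l _
      simp only [couplingMatrix, Matrix.of_apply]
      by_cases hl : Γ.vertexOf M l = Γ.vertexOf M i
      · simp [hl, h]
      · simp [hl]

/-- The value at `v` of the function on the extended graph with incoming amplitudes `z`. -/
noncomputable def vertexValue (z : Ends E M → ℂ) (v : V) : ℂ :=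
  Γ.vertexCoupling M k v * ∑ i with Γ.vertexOf M i = v, z i

/-- On the extended graph the vertex value is the one for which the outgoing amplitudes
`φ - z i` satisfy the `δ`-type condition. -/
theorem eq_vertexValue_iff (hk : k ≠ 0) (z : Ends E M → ℂ) {v : V} (hv : 0 < Γ.extDegree M v)
    (φ : ℂ) : φ = Γ.vertexValue M k z v ↔
      Γ.DeltaCondition v φ (∑ i with Γ.vertexOf M i = v, Complex.I * k * (φ - 2 * z i)) := by
  have hk' : (k : ℂ) ≠ 0 := by exact_mod_cast hk
  rw [← Finset.mul_sum, Finset.sum_sub_distrib, Finset.sum_const, ← Finset.mul_sum, nsmul_eq_mul,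
    ← extDegree]
  unfold vertexValue vertexCoupling DeltaCondition
  cases hα : Γ.α v with
  | top => simp
  | coe a =>
    simp only
    have h1 := natCast_add_I_mul_div_ne_zero hv a k
    rw [div_mul_eq_mul_div, eq_div_iff h1]
    constructor
    · intro h
      rw [← h]
      field_simp
      linear_combination (-(a : ℂ) * φ) * Complex.I_sq
    · intro h
      field_simp
      linear_combination (-Complex.I) * h +
        k * (Γ.extDegree M v * φ - 2 * ∑ i with Γ.vertexOf M i = v, z i) * Complex.I_sq

variable [DecidableEq E]

theorem vertexScattering_eq : Γ.vertexScattering M k = Γ.couplingMatrix M k - 1 := by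
  ext i j
  simp only [vertexScattering, couplingMatrix, Matrix.of_apply, Matrix.sub_apply, Matrix.one_apply]
  by_cases h : i = j
  · subst h; simp
  · simp [h]

theorem vertexScattering_unitary (hd : ∀ v, 0 < Γ.extDegree M v) :
    (Γ.vertexScattering M k)ᴴ * Γ.vertexScattering M k = 1 := by
  rw [vertexScattering_eq, Matrix.conjTranspose_sub, Matrix.conjTranspose_one, sub_mul, mul_sub,
    mul_sub, couplingMatrix_conjTranspose_mul Γ M k hd]
  simp

theorem flipMatrix_unitary : (flipMatrix E M)ᴴ * flipMatrix E M = 1 := by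
  ext i j
  simp only [Matrix.mul_apply, Matrix.conjTranspose_apply, flipMatrix, Matrix.of_apply,
    Matrix.one_apply]
  rw [Finset.sum_eq_single (flipEnds M i)]
  · simp [flipEnds_flipEnds]
  · intro l _ hl
    have : flipEnds M l ≠ i := by
      rintro rfl
      exact hl (flipEnds_flipEnds M l).symm
    simp [this]
  · simp

theorem evolution_unitary (hd : ∀ v, 0 < Γ.extDegree M v) :
    (Γ.evolution M k)ᴴ * Γ.evolution M k = 1 := by
  set D : Matrix (Ends E M) (Ends E M) ℂ :=
    Matrix.diagonal (fun i => Complex.exp (Complex.I * k * Γ.extLength M i)) with hD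
  have h1 : Dᴴ * D = 1 := by
    rw [hD, Matrix.diagonal_conjTranspose, Matrix.diagonal_mul_diagonal, ← Matrix.diagonal_one]
    congr 1
    ext i
    simp only [Pi.star_apply, RCLike.star_def]
    rw [← Complex.exp_conj, ← Complex.exp_add]
    simp
  have : Γ.evolution M k = D * flipMatrix E M * Γ.vertexScattering M k := rfl
  rw [this, Matrix.conjTranspose_mul, Matrix.conjTranspose_mul]
  calc _ = (Γ.vertexScattering M k)ᴴ * ((flipMatrix E M)ᴴ * (Dᴴ * D) * flipMatrix E M) *
        Γ.vertexScattering M k := by simp only [Matrix.mul_assoc]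
    _ = 1 := by rw [h1, Matrix.mul_one, flipMatrix_unitary, Matrix.mul_one,
        vertexScattering_unitary Γ M k hd]

theorem vertexScattering_mulVec (z : Ends E M → ℂ) (i : Ends E M) :
    (Γ.vertexScattering M k *ᵥ z) i = Γ.vertexValue M k z (Γ.vertexOf M i) - z i := by
  rw [vertexScattering_eq, Matrix.sub_mulVec, Matrix.one_mulVec, Pi.sub_apply]
  congr 1
  simp only [Matrix.mulVec, dotProduct, couplingMatrix, Matrix.of_apply, vertexValue, ite_mul,
    zero_mul, ← Finset.sum_filter, Finset.mul_sum, eq_comm]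

theorem evolution_mulVec (z : Ends E M → ℂ) (i : Ends E M) :
    (Γ.evolution M k *ᵥ z) i = Complex.exp (Complex.I * k * Γ.extLength M i) *
      (Γ.vertexValue M k z (Γ.vertexOf M (flipEnds M i)) - z (flipEnds M i)) := by
  rw [evolution, Matrix.mul_assoc, ← Matrix.mulVec_mulVec, Matrix.mulVec_diagonal,
    ← Matrix.mulVec_mulVec]
  congr 1
  rw [← vertexScattering_mulVec]
  simp [Matrix.mulVec, dotProduct, flipMatrix]

end Unitary

end QuantumGraph

/-! ### Sobolev functions on an interval -/

namespace QuantumGraph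

open Set

namespace IsH2

variable {ℓ : ℝ} {f f' f'' g g' g'' : ℝ → ℂ}

theorem intervalIntegrable_deriv2 (h : IsH2 ℓ f f' f'') {x : ℝ} (hx : x ∈ Icc 0 ℓ) :
    IntervalIntegrable f'' volume 0 x := by
  rw [intervalIntegrable_iff_integrableOn_Ioc_of_le hx.1]
  have : IntegrableOn f'' (Ioc 0 ℓ) := h.memLp.integrable one_le_two
  exact this.mono_set (Ioc_subset_Ioc_right hx.2)

theorem continuousOn_deriv (h : IsH2 ℓ f f' f'') : ContinuousOn f' (Icc 0 ℓ) := by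
  rcases lt_or_ge ℓ 0 with hℓ | hℓ
  · simp [Icc_eq_empty_of_lt hℓ]
  refine ContinuousOn.congr ?_ h.deriv_eq_integral
  have := intervalIntegral.continuousOn_primitive_interval'
    (h.intervalIntegrable_deriv2 ⟨hℓ, le_rfl⟩) left_mem_uIcc
  rw [uIcc_of_le hℓ] at this
  exact continuousOn_const.add this

theorem intervalIntegrable_deriv (h : IsH2 ℓ f f' f'') {x : ℝ} (hx : x ∈ Icc 0 ℓ) :
    IntervalIntegrable f' volume 0 x := by
  refine ContinuousOn.intervalIntegrable (h.continuousOn_deriv.mono ?_)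
  rw [uIcc_of_le hx.1]
  exact Icc_subset_Icc_right hx.2

theorem continuousOn (h : IsH2 ℓ f f' f'') : ContinuousOn f (Icc 0 ℓ) := by
  rcases lt_or_ge ℓ 0 with hℓ | hℓ
  · simp [Icc_eq_empty_of_lt hℓ]
  refine ContinuousOn.congr ?_ h.eq_integral
  have := intervalIntegral.continuousOn_primitive_interval'
    (h.intervalIntegrable_deriv ⟨hℓ, le_rfl⟩) left_mem_uIcc
  rw [uIcc_of_le hℓ] at this
  exact continuousOn_const.add this

theorem memLp_self (h : IsH2 ℓ f f' f'') : MemLp f 2 (volume.restrict (Ioc 0 ℓ)) := by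
  obtain ⟨C, hC⟩ := isCompact_Icc.exists_bound_of_continuousOn h.continuousOn
  refine MemLp.of_bound
    ((h.continuousOn.mono Ioc_subset_Icc_self).aestronglyMeasurable measurableSet_Ioc) C ?_
  filter_upwards [ae_restrict_mem measurableSet_Ioc] with x hx
  exact hC x (Ioc_subset_Icc_self hx)

theorem add (hf : IsH2 ℓ f f' f'') (hg : IsH2 ℓ g g' g'') :
    IsH2 ℓ (fun x => f x + g x) (fun x => f' x + g' x) (fun x => f'' x + g'' x) where
  memLp := hf.memLp.add hg.memLp
  eq_integral x hx := by
    rw [intervalIntegral.integral_add (hf.intervalIntegrable_deriv hx)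
      (hg.intervalIntegrable_deriv hx)]
    linear_combination hf.eq_integral x hx + hg.eq_integral x hx
  deriv_eq_integral x hx := by
    rw [intervalIntegral.integral_add (hf.intervalIntegrable_deriv2 hx)
      (hg.intervalIntegrable_deriv2 hx)]
    linear_combination hf.deriv_eq_integral x hx + hg.deriv_eq_integral x hx

theorem const_mul (c : ℂ) (hf : IsH2 ℓ f f' f'') :
    IsH2 ℓ (fun x => c * f x) (fun x => c * f' x) (fun x => c * f'' x) where
  memLp := hf.memLp.const_mul c
  eq_integral x hx := by
    rw [intervalIntegral.integral_const_mul]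
    linear_combination c * hf.eq_integral x hx
  deriv_eq_integral x hx := by
    rw [intervalIntegral.integral_const_mul]
    linear_combination c * hf.deriv_eq_integral x hx

theorem of_hasDerivAt (hf : ∀ x, HasDerivAt f (f' x) x) (hf' : ∀ x, HasDerivAt f' (f'' x) x)
    (hc : Continuous f'') : IsH2 ℓ f f' f'' where
  memLp := by
    obtain ⟨C, hC⟩ := isCompact_Icc.exists_bound_of_continuousOn (hc.continuousOn (s := Icc 0 ℓ))
    refine MemLp.of_bound hc.aestronglyMeasurable C ?_
    filter_upwards [ae_restrict_mem measurableSet_Ioc] with x hx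
    exact hC x (Ioc_subset_Icc_self hx)
  eq_integral x _ := by
    have hc' : Continuous f' := continuous_iff_continuousAt.2 fun x => (hf' x).continuousAt
    rw [intervalIntegral.integral_eq_sub_of_hasDerivAt (fun y _ => hf y)
      (hc'.intervalIntegrable 0 x)]
    ring
  deriv_eq_integral x _ := by
    rw [intervalIntegral.integral_eq_sub_of_hasDerivAt (fun y _ => hf' y)
      (hc.intervalIntegrable 0 x)]
    ring

end IsH2

/-! ### The equation `-f'' = k² f` on an interval -/

/-- The superposition of two plane waves on `[0, ℓ]`; `a` and `b` are the amplitudes of the waves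
arriving at the ends `0` and `ℓ`, measured at these ends. -/
noncomputable def wave (k ℓ : ℝ) (a b : ℂ) (x : ℝ) : ℂ :=
  a * Complex.exp (-(Complex.I * k * x)) + b * Complex.exp (-(Complex.I * k * (ℓ - x)))

/-- The derivative of `wave`. -/
noncomputable def waveDeriv (k ℓ : ℝ) (a b : ℂ) (x : ℝ) : ℂ :=
  Complex.I * k *
    (b * Complex.exp (-(Complex.I * k * (ℓ - x))) - a * Complex.exp (-(Complex.I * k * x)))

variable (k ℓ : ℝ) (a b : ℂ)

theorem hasDerivAt_exp_I_mul (x : ℝ) : HasDerivAt (fun x : ℝ => Complex.exp (Complex.I * k * x))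
    (Complex.I * k * Complex.exp (Complex.I * k * x)) x := by
  have h : HasDerivAt (fun x : ℝ => Complex.I * k * (x : ℂ)) (Complex.I * k * 1) x :=
    (Complex.ofRealCLM.hasDerivAt (x := x)).const_mul (Complex.I * k)
  convert h.cexp using 1
  ring

theorem hasDerivAt_exp_neg_I_mul (x : ℝ) :
    HasDerivAt (fun x : ℝ => Complex.exp (-(Complex.I * k * x)))
      (-(Complex.I * k) * Complex.exp (-(Complex.I * k * x))) x := by
  simpa using hasDerivAt_exp_I_mul (-k) x

theorem exp_neg_I_mul_sub (x : ℝ) : Complex.exp (-(Complex.I * k * (ℓ - x))) =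
    Complex.exp (-(Complex.I * k * ℓ)) * Complex.exp (Complex.I * k * x) := by
  rw [← Complex.exp_add]
  congr 1
  ring

theorem hasDerivAt_wave (x : ℝ) : HasDerivAt (wave k ℓ a b) (waveDeriv k ℓ a b x) x := by
  unfold wave waveDeriv
  simp only [exp_neg_I_mul_sub]
  refine (((hasDerivAt_exp_neg_I_mul k x).const_mul a).add
    (((hasDerivAt_exp_I_mul k x).const_mul _).const_mul b)).congr_deriv ?_
  ring

theorem hasDerivAt_waveDeriv (x : ℝ) :
    HasDerivAt (waveDeriv k ℓ a b) (-((k : ℂ) ^ 2 * wave k ℓ a b x)) x := by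
  unfold wave waveDeriv
  simp only [exp_neg_I_mul_sub]
  refine ((((((hasDerivAt_exp_I_mul k x).const_mul _).const_mul b).sub
    ((hasDerivAt_exp_neg_I_mul k x).const_mul a))).const_mul (Complex.I * k)).congr_deriv ?_
  ring_nf
  simp only [Complex.I_sq]
  ring

theorem continuous_wave : Continuous (wave k ℓ a b) :=
  continuous_iff_continuousAt.2 fun x => (hasDerivAt_wave k ℓ a b x).continuousAt

theorem isH2_wave :
    IsH2 ℓ (wave k ℓ a b) (waveDeriv k ℓ a b) (fun x => -((k : ℂ) ^ 2 * wave k ℓ a b x)) :=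
  .of_hasDerivAt (hasDerivAt_wave k ℓ a b) (hasDerivAt_waveDeriv k ℓ a b)
    (continuous_const.mul (continuous_wave k ℓ a b)).neg

variable {k ℓ a b}

theorem eq_zero_of_wave_ae_eq_zero (hk : k ≠ 0) (hℓ : 0 < ℓ)
    (h : wave k ℓ a b =ᵐ[volume.restrict (Ioc 0 ℓ)] 0) : a = 0 ∧ b = 0 := by
  have hk' : (k : ℂ) ≠ 0 := by exact_mod_cast hk
  have h0 := Measure.eqOn_Ioc_of_ae_eq volume h (continuous_wave k ℓ a b).continuousOn
    continuousOn_const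
  have hm : ℓ / 2 ∈ Ioo 0 ℓ := ⟨by linarith, by linarith⟩
  have h1 : wave k ℓ a b (ℓ / 2) = 0 := h0 (Ioo_subset_Ioc_self hm)
  have h2 : waveDeriv k ℓ a b (ℓ / 2) = 0 := by
    refine (hasDerivAt_wave k ℓ a b (ℓ / 2)).unique
      ((hasDerivAt_const (ℓ / 2) (0 : ℂ)).congr_of_eventuallyEq ?_)
    filter_upwards [isOpen_Ioo.mem_nhds hm] with x hx
    exact h0 (Ioo_subset_Ioc_self hx)
  rw [waveDeriv, mul_eq_zero, or_iff_right (mul_ne_zero Complex.I_ne_zero hk')] at h2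
  rw [wave] at h1
  have e1 : a * Complex.exp (-(Complex.I * k * (ℓ / 2 : ℝ))) = 0 := by
    linear_combination (h1 - h2) / 2
  have e2 : b * Complex.exp (-(Complex.I * k * (ℓ - (ℓ / 2 : ℝ)))) = 0 := by
    linear_combination (h1 + h2) / 2
  exact ⟨(mul_eq_zero.1 e1).resolve_right (Complex.exp_ne_zero _),
    (mul_eq_zero.1 e2).resolve_right (Complex.exp_ne_zero _)⟩

/-- Every `H²` solution of `-f'' = k² f` is a superposition of plane waves, because the functions
`(f' ± i k f) e^{∓ i k x}` are constant. -/
theorem IsH2.exists_eq_wave {f f' f'' : ℝ → ℂ} (hk : k ≠ 0) (hℓ : 0 < ℓ) (h : IsH2 ℓ f f' f'')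
    (heq : f'' =ᵐ[volume.restrict (Ioc 0 ℓ)] fun x => -((k : ℂ) ^ 2 * f x)) :
    ∃ a b, ∀ x ∈ Icc 0 ℓ, f x = wave k ℓ a b x ∧ f' x = waveDeriv k ℓ a b x := by
  have hk' : (k : ℂ) ≠ 0 := by exact_mod_cast hk
  -- `F'` and `F` extend `f'` and `f` from `[0, ℓ]` to functions that are differentiable on `ℝ`.
  set f₀ : ℝ → ℂ := IccExtend hℓ.le ((Icc 0 ℓ).domRestrict f) with hf₀
  have hf₀c : Continuous f₀ := h.continuousOn.domRestrict.Icc_extend'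
  have hf₀e : ∀ x ∈ Icc 0 ℓ, f₀ x = f x := fun x hx => IccExtend_of_mem _ _ hx
  set F' : ℝ → ℂ := fun x => f' 0 + ∫ t in (0 : ℝ)..x, -((k : ℂ) ^ 2 * f₀ t) with hF'
  have hF'd : ∀ x, HasDerivAt F' (-((k : ℂ) ^ 2 * f₀ x)) x := fun x =>
    ((continuous_const.mul hf₀c).neg.integral_hasStrictDerivAt 0 x).hasDerivAt.const_add _
  have hF'c : Continuous F' := continuous_iff_continuousAt.2 fun x => (hF'd x).continuousAt
  set F : ℝ → ℂ := fun x => f 0 + ∫ t in (0 : ℝ)..x, F' t with hF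
  have hFd : ∀ x, HasDerivAt F (F' x) x := fun x =>
    (hF'c.integral_hasStrictDerivAt 0 x).hasDerivAt.const_add _
  have hF'e : ∀ x ∈ Icc 0 ℓ, f' x = F' x := by
    intro x hx
    rw [h.deriv_eq_integral x hx, hF']
    simp only
    congr 1
    refine intervalIntegral.integral_congr_ae_restrict ?_
    rw [uIoc_of_le hx.1]
    have := ae_restrict_of_ae_restrict_of_subset (Ioc_subset_Ioc_right hx.2) heq
    filter_upwards [this, ae_restrict_mem measurableSet_Ioc] with y hy hy'
    rw [hy, hf₀e y ⟨hy'.1.le, hy'.2.trans hx.2⟩]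
  have hFe : ∀ x ∈ Icc 0 ℓ, f x = F x := by
    intro x hx
    rw [h.eq_integral x hx, hF]
    simp only
    congr 1
    refine intervalIntegral.integral_congr fun y hy => hF'e y ?_
    rw [uIcc_of_le hx.1] at hy
    exact ⟨hy.1, hy.2.trans hx.2⟩
  have hF'd2 : ∀ x ∈ Icc 0 ℓ, HasDerivAt F' (-((k : ℂ) ^ 2 * F x)) x := by
    intro x hx
    rw [← hFe x hx, ← hf₀e x hx]
    exact hF'd x
  have hFc : Continuous F := continuous_iff_continuousAt.2 fun x => (hFd x).continuousAt
  have hP : ∀ x ∈ Icc 0 ℓ, (F' x + Complex.I * k * F x) * Complex.exp (-(Complex.I * k * x)) =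
      F' 0 + Complex.I * k * F 0 := by
    have hd : ∀ x ∈ Icc 0 ℓ, HasDerivAt (fun x : ℝ => (F' x + Complex.I * k * F x) *
        Complex.exp (-(Complex.I * k * x))) 0 x := by
      intro x hx
      refine (((hF'd2 x hx).add ((hFd x).const_mul (Complex.I * k))).mul
        (hasDerivAt_exp_neg_I_mul k x)).congr_deriv ?_
      simp only [Pi.add_apply]
      linear_combination (-(k : ℂ) ^ 2 * F x * Complex.exp (-(Complex.I * k * x))) * Complex.I_sq
    intro x hx
    have := constant_of_has_deriv_right_zero
      (fun x hx => (hd x hx).continuousAt.continuousWithinAt)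
      (fun x hx => (hd x (Ico_subset_Icc_self hx)).hasDerivWithinAt) x hx
    simpa using this
  have hN : ∀ x ∈ Icc 0 ℓ, (F' x - Complex.I * k * F x) * Complex.exp (Complex.I * k * x) =
      F' 0 - Complex.I * k * F 0 := by
    have hd : ∀ x ∈ Icc 0 ℓ, HasDerivAt (fun x : ℝ => (F' x - Complex.I * k * F x) *
        Complex.exp (Complex.I * k * x)) 0 x := by
      intro x hx
      refine (((hF'd2 x hx).sub ((hFd x).const_mul (Complex.I * k))).mul
        (hasDerivAt_exp_I_mul k x)).congr_deriv ?_
      simp only [Pi.sub_apply]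
      linear_combination (-(k : ℂ) ^ 2 * F x * Complex.exp (Complex.I * k * x)) * Complex.I_sq
    intro x hx
    have := constant_of_has_deriv_right_zero
      (fun x hx => (hd x hx).continuousAt.continuousWithinAt)
      (fun x hx => (hd x (Ico_subset_Icc_self hx)).hasDerivWithinAt) x hx
    simpa using this
  refine ⟨-(F' 0 - Complex.I * k * F 0) / (2 * (Complex.I * k)),
    (F' 0 + Complex.I * k * F 0) / (2 * (Complex.I * k)) * Complex.exp (Complex.I * k * ℓ), ?_⟩
  intro x hx
  have hI : Complex.I * k ≠ 0 := mul_ne_zero Complex.I_ne_zero hk'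
  have e1 : Complex.exp (Complex.I * k * x) * Complex.exp (-(Complex.I * k * x)) = 1 := by
    rw [← Complex.exp_add]; simp
  have e2 : Complex.exp (Complex.I * k * ℓ) * Complex.exp (-(Complex.I * k * ℓ)) = 1 := by
    rw [← Complex.exp_add]; simp
  have p1 : F' x + Complex.I * k * F x =
      (F' 0 + Complex.I * k * F 0) * Complex.exp (Complex.I * k * x) := by
    linear_combination Complex.exp (Complex.I * k * x) * hP x hx -
      (F' x + Complex.I * k * F x) * e1
  have n1 : F' x - Complex.I * k * F x =
      (F' 0 - Complex.I * k * F 0) * Complex.exp (-(Complex.I * k * x)) := by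
    linear_combination Complex.exp (-(Complex.I * k * x)) * hN x hx -
      (F' x - Complex.I * k * F x) * e1
  rw [hFe x hx, hF'e x hx]
  unfold wave waveDeriv
  rw [exp_neg_I_mul_sub]
  generalize Complex.I * (k : ℂ) = κ at *
  constructor
  · field_simp
    linear_combination p1 - n1 + (F' 0 + κ * F 0) * Complex.exp (κ * x) * (-e2)
  · field_simp
    linear_combination p1 + n1 + (F' 0 + κ * F 0) * Complex.exp (κ * x) * (-e2)

/-- The inhomogeneous equation `-p'' = g + k² p` with vanishing initial values. One writes
`p = q - F₂`, where `F₂` is the second primitive of `g`; then `q'' + k² q = k² F₂` has a continuous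
right-hand side and is solved by the variation of constants. -/
theorem exists_isH2_particular {g : ℝ → ℂ}
    (hg : MemLp g 2 (volume.restrict (Ioc 0 ℓ))) :
    ∃ p p' : ℝ → ℂ, IsH2 ℓ p p' (fun x => -(g x + (k : ℂ) ^ 2 * p x)) ∧ p 0 = 0 ∧ p' 0 = 0 ∧
      (∀ x ∈ Icc 0 ℓ, ‖p x‖ ≤ (ℓ + |k| * ℓ ^ 2) * ∫ t in Ioc 0 ℓ, ‖g t‖) ∧
      ∀ x ∈ Icc 0 ℓ, ‖p' x‖ ≤ (1 + k ^ 2 * ℓ ^ 2) * ∫ t in Ioc 0 ℓ, ‖g t‖ := by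
  have hgi : IntegrableOn g (Ioc 0 ℓ) := hg.integrable one_le_two
  set N := ∫ t in Ioc 0 ℓ, ‖g t‖ with hN
  have hN0 : 0 ≤ N := integral_nonneg fun _ => norm_nonneg _
  set G : ℝ → ℂ := (Ioc 0 ℓ).indicator g with hG
  have hGi : Integrable G := hgi.integrable_indicator measurableSet_Ioc
  have hGI : ∀ a b, IntervalIntegrable G volume a b := fun a b => hGi.intervalIntegrable
  set F₁ : ℝ → ℂ := fun x => ∫ t in (0 : ℝ)..x, G t with hF₁
  have hF₁c : Continuous F₁ := intervalIntegral.continuous_primitive hGI 0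
  have hF₁b : ∀ x ∈ Icc 0 ℓ, ‖F₁ x‖ ≤ N := by
    intro x hx
    calc ‖F₁ x‖ ≤ ∫ t in Ioc 0 x, ‖G t‖ := by
          rw [← intervalIntegral.integral_of_le hx.1]
          exact intervalIntegral.norm_integral_le_integral_norm hx.1
      _ = ∫ t in Ioc 0 x, ‖g t‖ := by
          refine setIntegral_congr_fun measurableSet_Ioc fun t ht => ?_
          simp only [hG, indicator_of_mem (Ioc_subset_Ioc_right hx.2 ht)]
      _ ≤ N := setIntegral_mono_set hgi.norm (ae_of_all _ fun _ => norm_nonneg _)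
          (Ioc_subset_Ioc_right hx.2).eventuallyLE
  set F₂ : ℝ → ℂ := fun x => ∫ t in (0 : ℝ)..x, F₁ t with hF₂
  have hF₂d : ∀ x, HasDerivAt F₂ (F₁ x) x := fun x =>
    (hF₁c.integral_hasStrictDerivAt 0 x).hasDerivAt
  have hF₂c : Continuous F₂ := continuous_iff_continuousAt.2 fun x => (hF₂d x).continuousAt
  -- Primitives of functions bounded by `C` on `[0, ℓ]` are bounded by `C * ℓ`.
  have hbound : ∀ (φ : ℝ → ℂ) (C : ℝ), (∀ x ∈ Icc 0 ℓ, ‖φ x‖ ≤ C) → ∀ x ∈ Icc 0 ℓ,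
      ‖∫ t in (0 : ℝ)..x, φ t‖ ≤ C * ℓ := by
    intro φ C hφ x hx
    have hC : 0 ≤ C := (norm_nonneg _).trans (hφ x hx)
    refine (intervalIntegral.norm_integral_le_of_norm_le_const (C := C) fun t ht => ?_).trans ?_
    · rw [uIoc_of_le hx.1] at ht
      exact hφ t ⟨ht.1.le, ht.2.trans hx.2⟩
    · rw [sub_zero, abs_of_nonneg hx.1]
      exact mul_le_mul_of_nonneg_left hx.2 hC
  have hF₂b : ∀ x ∈ Icc 0 ℓ, ‖F₂ x‖ ≤ N * ℓ := hbound F₁ N hF₁b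
  have hE : ∀ x : ℝ, ‖Complex.exp (Complex.I * k * x)‖ = 1 := by
    intro x
    rw [Complex.norm_exp]; simp
  have hE' : ∀ x : ℝ, ‖Complex.exp (-(Complex.I * k * x))‖ = 1 := by
    intro x
    rw [Complex.norm_exp]; simp
  -- Variation of constants: `q x = k ∫₀ˣ sin (k (x - t)) F₂ t dt`, written with exponentials.
  set W : ℝ → ℂ := fun x => ∫ t in (0 : ℝ)..x, Complex.exp (-(Complex.I * k * t)) * F₂ t with hW
  set W' : ℝ → ℂ := fun x => ∫ t in (0 : ℝ)..x, Complex.exp (Complex.I * k * t) * F₂ t with hW'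
  have hWd : ∀ x : ℝ, HasDerivAt W (Complex.exp (-(Complex.I * k * x)) * F₂ x) x := fun x =>
    (Continuous.integral_hasStrictDerivAt (by fun_prop) 0 x).hasDerivAt
  have hW'd : ∀ x : ℝ, HasDerivAt W' (Complex.exp (Complex.I * k * x) * F₂ x) x := fun x =>
    (Continuous.integral_hasStrictDerivAt (by fun_prop) 0 x).hasDerivAt
  have hWb : ∀ x ∈ Icc 0 ℓ, ‖W x‖ ≤ N * ℓ * ℓ := by
    refine hbound _ _ fun x hx => ?_
    rw [norm_mul, hE', one_mul]
    exact hF₂b x hx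
  have hW'b : ∀ x ∈ Icc 0 ℓ, ‖W' x‖ ≤ N * ℓ * ℓ := by
    refine hbound _ _ fun x hx => ?_
    rw [norm_mul, hE, one_mul]
    exact hF₂b x hx
  set q : ℝ → ℂ := fun x => -(Complex.I * k / 2) * (Complex.exp (Complex.I * k * x) * W x -
    Complex.exp (-(Complex.I * k * x)) * W' x) with hq
  set q' : ℝ → ℂ := fun x => (k : ℂ) ^ 2 / 2 * (Complex.exp (Complex.I * k * x) * W x +
    Complex.exp (-(Complex.I * k * x)) * W' x) with hq'
  have e1 : ∀ x : ℝ, Complex.exp (Complex.I * k * x) * Complex.exp (-(Complex.I * k * x)) = 1 := by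
    intro x
    rw [← Complex.exp_add]; simp
  have hqd : ∀ x, HasDerivAt q (q' x) x := by
    intro x
    refine ((((hasDerivAt_exp_I_mul k x).mul (hWd x)).sub
      ((hasDerivAt_exp_neg_I_mul k x).mul (hW'd x))).const_mul _).congr_deriv ?_
    simp only [hq']
    linear_combination (-(k : ℂ) ^ 2 / 2 * (Complex.exp (Complex.I * k * x) * W x +
      Complex.exp (-(Complex.I * k * x)) * W' x)) * Complex.I_sq
  have hq'd : ∀ x, HasDerivAt q' ((k : ℂ) ^ 2 * F₂ x - (k : ℂ) ^ 2 * q x) x := by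
    intro x
    refine ((((hasDerivAt_exp_I_mul k x).mul (hWd x)).add
      ((hasDerivAt_exp_neg_I_mul k x).mul (hW'd x))).const_mul _).congr_deriv ?_
    simp only [hq]
    linear_combination (k : ℂ) ^ 2 * F₂ x * e1 x
  have hqc : Continuous q := continuous_iff_continuousAt.2 fun x => (hqd x).continuousAt
  have hq'c : Continuous q' := continuous_iff_continuousAt.2 fun x => (hq'd x).continuousAt
  have hsum : ∀ x ∈ Icc 0 ℓ, ‖Complex.exp (Complex.I * k * x) * W x‖ +
      ‖Complex.exp (-(Complex.I * k * x)) * W' x‖ ≤ 2 * (N * ℓ * ℓ) := by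
    intro x hx
    rw [norm_mul, norm_mul, hE, hE', one_mul, one_mul]
    linarith [hWb x hx, hW'b x hx]
  have hpint : ∀ x, q' x - F₁ x =
      q' 0 - F₁ 0 + ∫ t in (0 : ℝ)..x, -(G t + (k : ℂ) ^ 2 * (q t - F₂ t)) := by
    intro x
    have h1 : ∫ t in (0 : ℝ)..x, ((k : ℂ) ^ 2 * F₂ t - (k : ℂ) ^ 2 * q t) = q' x - q' 0 :=
      intervalIntegral.integral_eq_sub_of_hasDerivAt (fun y _ => hq'd y)
        (Continuous.intervalIntegrable (by fun_prop) 0 x)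
    have h2 : ∫ t in (0 : ℝ)..x, -(G t + (k : ℂ) ^ 2 * (q t - F₂ t)) =
        (∫ t in (0 : ℝ)..x, ((k : ℂ) ^ 2 * F₂ t - (k : ℂ) ^ 2 * q t)) - F₁ x := by
      rw [hF₁, ← intervalIntegral.integral_sub
        (Continuous.intervalIntegrable (by fun_prop) 0 x) (hGI 0 x)]
      congr 1
      ext t
      ring
    have h3 : F₁ 0 = 0 := by simp [hF₁]
    rw [h2, h1, h3]
    ring
  have hGg : ∀ x ∈ Ioc 0 ℓ, G x = g x := fun x hx => indicator_of_mem hx g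
  refine ⟨fun x => q x - F₂ x, fun x => q' x - F₁ x, ⟨?_, ?_, ?_⟩, ?_, ?_, ?_, ?_⟩
  · refine (hg.add (MemLp.const_mul (f := fun x => q x - F₂ x) ?_ ((k : ℂ) ^ 2))).neg
    have hc : Continuous fun x => q x - F₂ x := by fun_prop
    obtain ⟨C, hC⟩ := isCompact_Icc.exists_bound_of_continuousOn (hc.continuousOn (s := Icc 0 ℓ))
    refine MemLp.of_bound hc.aestronglyMeasurable C ?_
    filter_upwards [ae_restrict_mem measurableSet_Ioc] with x hx
    exact hC x (Ioc_subset_Icc_self hx)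
  · intro x _
    rw [intervalIntegral.integral_eq_sub_of_hasDerivAt (fun y _ => (hqd y).sub (hF₂d y))
      (Continuous.intervalIntegrable (by fun_prop) 0 x)]
    simp
  · intro x hx
    rw [hpint x]
    congr 1
    refine intervalIntegral.integral_congr_ae (ae_of_all _ fun t ht => ?_)
    rw [uIoc_of_le hx.1] at ht
    rw [hGg t ⟨ht.1, ht.2.trans hx.2⟩]
  · simp [hq, hF₂, hW, hW']
  · simp [hq', hF₁, hW, hW']
  · intro x hx
    have h1 : ‖q x‖ ≤ |k| / 2 * (2 * (N * ℓ * ℓ)) := by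
      rw [hq]
      simp only
      rw [norm_mul]
      refine mul_le_mul (by simp) ((norm_sub_le _ _).trans (hsum x hx)) (norm_nonneg _)
        (by positivity)
    calc ‖q x - F₂ x‖ ≤ ‖q x‖ + ‖F₂ x‖ := norm_sub_le _ _
      _ ≤ |k| / 2 * (2 * (N * ℓ * ℓ)) + N * ℓ := add_le_add h1 (hF₂b x hx)
      _ = _ := by ring
  · intro x hx
    have h1 : ‖q' x‖ ≤ k ^ 2 / 2 * (2 * (N * ℓ * ℓ)) := by
      rw [hq']
      simp only
      rw [norm_mul]
      refine mul_le_mul (by simp) ((norm_add_le _ _).trans (hsum x hx)) (norm_nonneg _)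
        (by positivity)
    calc ‖q' x - F₁ x‖ ≤ ‖q' x‖ + ‖F₁ x‖ := norm_sub_le _ _
      _ ≤ k ^ 2 / 2 * (2 * (N * ℓ * ℓ)) + N := add_le_add h1 (hF₁b x hx)
      _ = _ := by ring

theorem integral_norm_Lp_two_le (ℓ : ℝ) : ∃ K : ℝ, 0 ≤ K ∧
    ∀ g : Lp ℂ 2 (volume.restrict (Ioc 0 ℓ)), ∫ t in Ioc 0 ℓ, ‖g t‖ ≤ K * ‖g‖ := by
  refine ⟨((volume.restrict (Ioc 0 ℓ)) univ ^ ((1 : ℝ) - 1 / 2)).toReal,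
    ENNReal.toReal_nonneg, ?_⟩
  intro g
  have h := eLpNorm_le_eLpNorm_mul_rpow_measure_univ (μ := volume.restrict (Ioc 0 ℓ))
    (p := 1) (q := 2) one_le_two (Lp.aestronglyMeasurable g)
  rw [integral_norm_eq_lintegral_enorm (Lp.aestronglyMeasurable g),
    ← eLpNorm_one_eq_lintegral_enorm, Lp.norm_def, mul_comm, ← ENNReal.toReal_mul]
  refine ENNReal.toReal_mono ?_ (by simpa using h)
  refine ENNReal.mul_ne_top (Lp.eLpNorm_ne_top g) (ENNReal.rpow_ne_top_of_nonneg (by norm_num) ?_)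
  exact measure_ne_top _ _

end QuantumGraph

namespace QuantumGraph

/-! ### Plane waves on the graph and the fixed vectors of the evolution matrix -/

section Waves

open Matrix

variable {V E : Type*} (Γ : QuantumGraph V E) (k : ℝ)

/-- The function on the graph with the amplitude `a h` of the wave arriving at the end `h`. -/
noncomputable def graphWave (a : E × Bool → ℂ) (e : E) : ℝ → ℂ :=
  wave k (Γ.length e) (a (e, false)) (a (e, true))

/-- The derivative of `graphWave`. -/
noncomputable def graphWaveDeriv (a : E × Bool → ℂ) (e : E) : ℝ → ℂ :=
  waveDeriv k (Γ.length e) (a (e, false)) (a (e, true))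

theorem endValue_graphWave (a : E × Bool → ℂ) (h : E × Bool) :
    Γ.endValue (Γ.graphWave k a) h =
      a h + Complex.exp (-(Complex.I * k * Γ.length h.1)) * a (h.1, !h.2) := by
  rcases h with ⟨e, _ | _⟩ <;> simp [endValue, graphWave, wave] <;> ring

theorem endDeriv_graphWaveDeriv (a : E × Bool → ℂ) (h : E × Bool) :
    Γ.endDeriv (Γ.graphWaveDeriv k a) h = Complex.I * k *
      (Complex.exp (-(Complex.I * k * Γ.length h.1)) * a (h.1, !h.2) - a h) := by
  rcases h with ⟨e, _ | _⟩ <;>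
    simp [endDeriv, graphWaveDeriv, waveDeriv, -mul_eq_mul_left_iff] <;> ring

variable [DecidableEq V] [Fintype E]

theorem VertexConditions.congr {Γ : QuantumGraph V E} {D : Finset V} {f f' g g' : E → ℝ → ℂ}
    (h : Γ.VertexConditions D f f')
    (hv : ∀ e, ∀ x ∈ Set.Icc 0 (Γ.length e), f e x = g e x ∧ f' e x = g' e x) :
    Γ.VertexConditions D g g' := by
  have h0 : ∀ e, f e 0 = g e 0 ∧ f' e 0 = g' e 0 := fun e =>
    hv e 0 ⟨le_rfl, (Γ.length_pos e).le⟩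
  have h1 : ∀ e, f e (Γ.length e) = g e (Γ.length e) ∧ f' e (Γ.length e) = g' e (Γ.length e) :=
    fun e => hv e _ ⟨(Γ.length_pos e).le, le_rfl⟩
  obtain ⟨φ, hφ, hδ, hD⟩ := h
  refine ⟨φ, fun h => ?_, fun v => ?_, hD⟩
  · rw [← hφ, endValue, endValue, (h0 _).1, (h1 _).1]
  · convert hδ v using 2
    rw [endDeriv, endDeriv, (h0 _).2, (h1 _).2]

variable [DecidableEq E] (M : Finset V)

/-- The vector `(c, a)` of incoming amplitudes reproduces the edge amplitudes `a` if and only if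
the plane waves are continuous and satisfy the `δ`-type conditions of the extended graph, in
which the lead at `v` contributes the derivative `i k (φ v - 2 c v)`. -/
theorem evolution_mulVec_inr_eq_iff (hk : k ≠ 0) (hd : ∀ v, 0 < Γ.extDegree M v)
    (c : {v // v ∈ M} → ℂ) (a : E × Bool → ℂ) (φ : V → ℂ) :
    ((∀ v, φ v = Γ.vertexValue M k (Sum.elim c a) v) ∧
        ∀ h, (Γ.evolution M k *ᵥ Sum.elim c a) (Sum.inr h) = a h) ↔
      (∀ h : E × Bool, Γ.endValue (Γ.graphWave k a) h = φ (Γ.endpt h.1 h.2)) ∧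
      ∀ v, Γ.DeltaCondition v (φ v)
        (∑ h : E × Bool with Γ.endpt h.1 h.2 = v, Γ.endDeriv (Γ.graphWaveDeriv k a) h +
          ∑ l : {v // v ∈ M} with l.1 = v, Complex.I * k * (φ v - 2 * c l)) := by
  have hsum : (∀ h : E × Bool, Γ.endValue (Γ.graphWave k a) h = φ (Γ.endpt h.1 h.2)) → ∀ v,
      ∑ i with Γ.vertexOf M i = v, Complex.I * k * (φ v - 2 * Sum.elim c a i) =
        ∑ h : E × Bool with Γ.endpt h.1 h.2 = v, Γ.endDeriv (Γ.graphWaveDeriv k a) h +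
          ∑ l : {v // v ∈ M} with l.1 = v, Complex.I * k * (φ v - 2 * c l) := by
    intro h v
    rw [Finset.sum_filter, Fintype.sum_sum_type, Finset.sum_filter, Finset.sum_filter, add_comm]
    congr 1
    refine Finset.sum_congr rfl fun i _ => ?_
    have hv : Γ.vertexOf M (Sum.inr i) = Γ.endpt i.1 i.2 := rfl
    by_cases hi : Γ.endpt i.1 i.2 = v
    · have hφ := h i
      rw [hi] at hφ
      rw [if_pos (hv.trans hi), if_pos hi, ← hφ, Sum.elim_inr, endValue_graphWave,
        endDeriv_graphWaveDeriv]
      ring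
    · rw [if_neg (hv ▸ hi), if_neg hi]
  have hedge : (∀ v, φ v = Γ.vertexValue M k (Sum.elim c a) v) →
      ((∀ h, (Γ.evolution M k *ᵥ Sum.elim c a) (Sum.inr h) = a h) ↔
        ∀ h : E × Bool, Γ.endValue (Γ.graphWave k a) h = φ (Γ.endpt h.1 h.2)) := by
    intro hφ
    have hflip : Function.Surjective fun h : E × Bool => (h.1, !h.2) := fun h =>
      ⟨(h.1, !h.2), by simp⟩
    -- The component of `Q z` at an end is the continuity condition at the other end of the edge.
    rw [hflip.forall]
    refine forall_congr' fun h => ?_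
    rw [evolution_mulVec, ← hφ, endValue_graphWave, Complex.exp_neg]
    simp only [extLength, flipEnds, vertexOf, Sum.elim_inr, Sum.map_inr, Bool.not_not]
    have := Complex.exp_ne_zero (Complex.I * k * Γ.length h.1)
    field_simp
    constructor
    · intro h; linear_combination -h
    · intro h; linear_combination -h
  constructor
  · rintro ⟨hφ, hQ⟩
    have hc := (hedge hφ).1 hQ
    refine ⟨hc, fun v => ?_⟩
    rw [← hsum hc]
    exact (Γ.eq_vertexValue_iff M k hk _ (hd v) _).1 (hφ v)
  · rintro ⟨hc, hδ⟩
    have hφ : ∀ v, φ v = Γ.vertexValue M k (Sum.elim c a) v := fun v =>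
      (Γ.eq_vertexValue_iff M k hk _ (hd v) _).2 (by rw [hsum hc]; exact hδ v)
    exact ⟨hφ, (hedge hφ).2 hc⟩

theorem evolution_mulVec_inl (z : Ends E M → ℂ) (l : {v // v ∈ M}) :
    (Γ.evolution M k *ᵥ z) (Sum.inl l) = Γ.vertexValue M k z l.1 - z (Sum.inl l) := by
  rw [evolution_mulVec]
  simp [extLength, flipEnds, vertexOf]

variable [Nonempty E]

/-- A fixed vector of `Q(k)` has outgoing equal to incoming amplitudes on the leads. Then the
derivative along each lead vanishes at its vertex, and what remains on `Γ` satisfies the vertex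
conditions of `Γ`. Conversely the lead amplitude is half of the value at the marked vertex. -/
theorem det_one_sub_evolution_eq_zero_iff (hΓ : Γ.Connected) (hk : k ≠ 0) :
    (1 - Γ.evolution M k).det = 0 ↔
      ∃ a ≠ 0, Γ.VertexConditions ∅ (Γ.graphWave k a) (Γ.graphWaveDeriv k a) := by
  have hd := Γ.extDegree_pos M hΓ
  rw [Matrix.det_one_sub_eq_zero_iff]
  constructor
  · rintro ⟨z, hz, h⟩
    obtain ⟨c, a, rfl⟩ : ∃ c a, z = Sum.elim c a :=
      ⟨z ∘ Sum.inl, z ∘ Sum.inr, (Sum.elim_comp_inl_inr z).symm⟩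
    obtain ⟨hc, hδ⟩ := (Γ.evolution_mulVec_inr_eq_iff k M hk hd c a _).1
      ⟨fun _ => rfl, fun i => congrFun h (Sum.inr i)⟩
    set φ := Γ.vertexValue M k (Sum.elim c a) with hφ
    have hl : ∀ l : {v // v ∈ M}, φ l.1 - 2 * c l = 0 := by
      intro l
      have := congrFun h (Sum.inl l)
      rw [evolution_mulVec_inl, ← hφ] at this
      simp only [Sum.elim_inl] at this
      linear_combination this
    refine ⟨a, ?_, φ, hc, fun v => ?_, by simp⟩
    · rintro rfl
      -- Without waves on the edges all vertex values vanish, hence so do the lead amplitudes.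
      have hφ0 : ∀ v, φ v = 0 := by
        intro v
        obtain ⟨i, rfl⟩ := Γ.exists_endpt_eq hΓ v
        rw [← hc, endValue_graphWave]
        simp
      apply hz
      ext i
      rcases i with l | i
      · have := hl l
        rw [hφ0] at this
        simpa using this
      · rfl
    · have := hδ v
      rwa [Finset.sum_eq_zero (s := Finset.univ.filter fun l : {v // v ∈ M} => l.1 = v),
        add_zero] at this
      intro l hlv
      rw [← (Finset.mem_filter.1 hlv).2, hl, mul_zero]
  · rintro ⟨a, ha, φ, hc, hδ, -⟩
    obtain ⟨hφ, hQ⟩ := (Γ.evolution_mulVec_inr_eq_iff k M hk hd (fun l => φ l.1 / 2) a φ).2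
      ⟨hc, fun v => by
        rw [Finset.sum_eq_zero (s := Finset.univ.filter fun l : {v // v ∈ M} => l.1 = v), add_zero]
        · exact hδ v
        · intro l hl
          rw [(Finset.mem_filter.1 hl).2]
          ring⟩
    refine ⟨Sum.elim (fun l => φ l.1 / 2) a,
      fun h0 => ha (funext fun i => congrFun h0 (Sum.inr i)), ?_⟩
    ext i
    rcases i with l | i
    · rw [evolution_mulVec_inl, ← hφ]
      simp only [Sum.elim_inl]
      ring
    · exact hQ i

/-- A fixed vector of `Ũ(k)` is a solution on the extended graph without incoming waves on the
leads; by unitarity there are no outgoing waves either, so that it vanishes at the marked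
vertices. -/
theorem det_one_sub_matU_eq_zero_iff (hΓ : Γ.Connected) (hk : k ≠ 0) :
    (1 - Γ.matU M k).det = 0 ↔
      ∃ a ≠ 0, Γ.VertexConditions M (Γ.graphWave k a) (Γ.graphWaveDeriv k a) := by
  have hd := Γ.extDegree_pos M hΓ
  have hQ := Γ.evolution_unitary M k hd
  rw [Matrix.det_one_sub_eq_zero_iff, matU]
  refine exists_congr fun a => and_congr_right fun _ => ?_
  have hlead : ∀ φ : V → ℂ, (∀ v ∈ M, φ v = 0) → ∀ v,
      ∑ l : {v // v ∈ M} with l.1 = v, Complex.I * k * (φ v - 2 * (0 : {v // v ∈ M} → ℂ) l) =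
        0 := by
    intro φ hφ v
    refine Finset.sum_eq_zero fun l hl => ?_
    rw [← (Finset.mem_filter.1 hl).2, hφ l.1 l.2]
    simp
  have hblock := Matrix.mulVec_sum_elim (Γ.evolution M k) 0 a
  simp only [mulVec_zero, zero_add] at hblock
  constructor
  · intro h
    have h' : Γ.evolution M k *ᵥ Sum.elim 0 a = Sum.elim (0 : {v // v ∈ M} → ℂ) a := by
      rw [hblock, Matrix.toBlocks₁₂_mulVec_eq_zero hQ h, h]
    obtain ⟨hc, hδ⟩ := (Γ.evolution_mulVec_inr_eq_iff k M hk hd 0 a _).1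
      ⟨fun _ => rfl, fun i => congrFun h' (Sum.inr i)⟩
    have hM : ∀ v ∈ M, Γ.vertexValue M k (Sum.elim 0 a) v = 0 := by
      intro v hv
      have := congrFun h' (Sum.inl ⟨v, hv⟩)
      rw [evolution_mulVec_inl] at this
      simpa using this
    refine ⟨_, hc, fun v => ?_, hM⟩
    have := hδ v
    rwa [hlead _ hM, add_zero] at this
  · rintro ⟨φ, hc, hδ, hM⟩
    have := ((Γ.evolution_mulVec_inr_eq_iff k M hk hd 0 a φ).2
      ⟨hc, fun v => by rw [hlead _ hM, add_zero]; exact hδ v⟩).2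
    rw [hblock] at this
    exact funext this

end Waves

/-! ### Eigenfunctions -/

section Eigenfunctions

variable {V E : Type*} [DecidableEq V] [Fintype E] {Γ : QuantumGraph V E} {k : ℝ} {D : Finset V}

/-- For `k ≠ 0` the eigenfunctions with the eigenvalue `k²` are the plane waves that satisfy the
vertex conditions. -/
theorem exists_hamiltonianEq_smul_iff (hk : k ≠ 0) :
    (∃ u : Γ.L2, u ≠ 0 ∧ Γ.HamiltonianEq D u (((k : ℂ) ^ 2) • u)) ↔
      ∃ a ≠ 0, Γ.VertexConditions D (Γ.graphWave k a) (Γ.graphWaveDeriv k a) := by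
  constructor
  · rintro ⟨u, hu, f, f', f'', hf, hV, huf, hw⟩
    have h : ∀ e, ∃ a b, ∀ x ∈ Set.Icc 0 (Γ.length e),
        f e x = wave k (Γ.length e) a b x ∧ f' e x = waveDeriv k (Γ.length e) a b x := by
      intro e
      refine (hf e).exists_eq_wave hk (Γ.length_pos e) ?_
      have h1 : (((k : ℂ) ^ 2) • u) e = ((k : ℂ) ^ 2) • u e := rfl
      have h2 := hw e
      rw [h1] at h2
      filter_upwards [h2, huf e, Lp.coeFn_smul ((k : ℂ) ^ 2) (u e)] with x h2 h3 h4
      rw [h4, Pi.smul_apply, h3, smul_eq_mul] at h2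
      rw [h2, neg_neg]
    choose a b hab using h
    set A : E × Bool → ℂ := fun h => if h.2 then b h.1 else a h.1 with hA
    have hAe : ∀ e, ∀ x ∈ Set.Icc 0 (Γ.length e),
        f e x = Γ.graphWave k A e x ∧ f' e x = Γ.graphWaveDeriv k A e x := by
      intro e x hx
      simpa [graphWave, graphWaveDeriv, hA] using hab e x hx
    refine ⟨A, ?_, hV.congr hAe⟩
    intro h0
    apply hu
    ext e : 1
    refine Lp.eq_zero_iff_ae_eq_zero.2 ?_
    filter_upwards [huf e, ae_restrict_mem measurableSet_Ioc] with x hx hx'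
    rw [hx, (hAe e x (Set.Ioc_subset_Icc_self hx')).1, h0]
    simp [graphWave, wave]
  · rintro ⟨a, ha, hV⟩
    have hH : ∀ e, IsH2 (Γ.length e) (Γ.graphWave k a e) (Γ.graphWaveDeriv k a e)
        (fun x => -((k : ℂ) ^ 2 * Γ.graphWave k a e x)) := fun e => isH2_wave k _ _ _
    have hu : ∀ e, (hH e).memLp_self.toLp (Γ.graphWave k a e)
        =ᵐ[volume.restrict (Set.Ioc 0 (Γ.length e))] Γ.graphWave k a e := fun e =>
      MemLp.coeFn_toLp _
    refine ⟨WithLp.toLp 2 fun e => (hH e).memLp_self.toLp (Γ.graphWave k a e), ?_, _, _, _, hH, hV,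
      hu, fun e => ?_⟩
    · intro h0
      apply ha
      have h1 : ∀ e, a (e, false) = 0 ∧ a (e, true) = 0 := by
        intro e
        refine eq_zero_of_wave_ae_eq_zero hk (Γ.length_pos e) ((hu e).symm.trans ?_)
        have h2 : (hH e).memLp_self.toLp (Γ.graphWave k a e) = 0 :=
          congrFun (congrArg WithLp.ofLp h0) e
        rw [h2]
        exact Lp.coeFn_zero _ _ _
      ext ⟨e, _ | _⟩
      · exact (h1 e).1
      · exact (h1 e).2
    · refine (Lp.coeFn_smul ((k : ℂ) ^ 2) ((hH e).memLp_self.toLp (Γ.graphWave k a e))).trans ?_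
      filter_upwards [hu e] with x hx
      rw [Pi.smul_apply, hx, smul_eq_mul, neg_neg]

end Eigenfunctions

end QuantumGraph

namespace QuantumGraph

/-! ### The resolvent -/

section Resolvent

variable {V E : Type*}

/-- The `δ`-type condition is one linear equation. The bound on the coefficient of the derivative
serves to bound the boundary data of a particular solution. -/
theorem exists_deltaCondition_iff (Γ : QuantumGraph V E) (v : V) :
    ∃ p q : ℂ, ‖q‖ ≤ 1 ∧ ∀ y y', Γ.DeltaCondition v y y' ↔ p * y + q * y' = 0 := by
  unfold DeltaCondition
  cases hα : Γ.α v with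
  | top => exact ⟨1, 0, by simp, by simp⟩
  | coe a =>
    refine ⟨-a, 1, by simp, fun y y' => ?_⟩
    simp only
    constructor
    · intro h; linear_combination h
    · intro h; linear_combination h

theorem endValue_add (Γ : QuantumGraph V E) (f g : E → ℝ → ℂ) (h : E × Bool) :
    Γ.endValue (fun e x => f e x + g e x) h = Γ.endValue f h + Γ.endValue g h := by
  rw [endValue, endValue, endValue]
  split_ifs <;> rfl

theorem endDeriv_add (Γ : QuantumGraph V E) (f g : E → ℝ → ℂ) (h : E × Bool) :
    Γ.endDeriv (fun e x => f e x + g e x) h = Γ.endDeriv f h + Γ.endDeriv g h := by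
  rw [endDeriv, endDeriv, endDeriv]
  split_ifs
  · ring
  · rfl

theorem endValue_const_mul (Γ : QuantumGraph V E) (c : ℂ) (f : E → ℝ → ℂ) (h : E × Bool) :
    Γ.endValue (fun e x => c * f e x) h = c * Γ.endValue f h := by
  rw [endValue, endValue]
  split_ifs <;> rfl

theorem endDeriv_const_mul (Γ : QuantumGraph V E) (c : ℂ) (f : E → ℝ → ℂ) (h : E × Bool) :
    Γ.endDeriv (fun e x => c * f e x) h = c * Γ.endDeriv f h := by
  rw [endDeriv, endDeriv]
  split_ifs
  · ring
  · rfl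

variable [DecidableEq V] [Fintype E] {Γ : QuantumGraph V E} {k : ℝ} {D : Finset V}

theorem VertexConditions.add {f f' g g' : E → ℝ → ℂ} (hf : Γ.VertexConditions D f f')
    (hg : Γ.VertexConditions D g g') :
    Γ.VertexConditions D (fun e x => f e x + g e x) (fun e x => f' e x + g' e x) := by
  obtain ⟨φ, hφ, hδ, hD⟩ := hf
  obtain ⟨ψ, hψ, hε, hD'⟩ := hg
  refine ⟨fun v => φ v + ψ v, fun h => ?_, fun v => ?_, fun v hv => ?_⟩
  · rw [endValue_add, hφ, hψ]
  · obtain ⟨p, q, -, hpq⟩ := Γ.exists_deltaCondition_iff v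
    have h1 := (hpq _ _).1 (hδ v)
    have h2 := (hpq _ _).1 (hε v)
    rw [hpq]
    simp only [endDeriv_add, Finset.sum_add_distrib]
    linear_combination h1 + h2
  · simp only [hD v hv, hD' v hv, add_zero]

theorem VertexConditions.const_mul {f f' : E → ℝ → ℂ} (c : ℂ) (hf : Γ.VertexConditions D f f') :
    Γ.VertexConditions D (fun e x => c * f e x) (fun e x => c * f' e x) := by
  obtain ⟨φ, hφ, hδ, hD⟩ := hf
  refine ⟨fun v => c * φ v, fun h => ?_, fun v => ?_, fun v hv => ?_⟩
  · rw [endValue_const_mul, hφ]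
  · obtain ⟨p, q, -, hpq⟩ := Γ.exists_deltaCondition_iff v
    have h1 := (hpq _ _).1 (hδ v)
    rw [hpq]
    simp only [endDeriv_const_mul, ← Finset.mul_sum]
    linear_combination c * h1
  · simp only [hD v hv, mul_zero]

theorem HamiltonianEq.add {u w u' w' : Γ.L2} (h : Γ.HamiltonianEq D u w)
    (h' : Γ.HamiltonianEq D u' w') : Γ.HamiltonianEq D (u + u') (w + w') := by
  obtain ⟨f, f', f'', hf, hV, hu, hw⟩ := h
  obtain ⟨g, g', g'', hg, hV', hu', hw'⟩ := h'
  refine ⟨_, _, _, fun e => (hf e).add (hg e), hV.add hV', fun e => ?_, fun e => ?_⟩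
  · refine (Lp.coeFn_add (u e) (u' e)).trans ?_
    filter_upwards [hu e, hu' e] with x h1 h2
    rw [Pi.add_apply, h1, h2]
  · refine (Lp.coeFn_add (w e) (w' e)).trans ?_
    filter_upwards [hw e, hw' e] with x h1 h2
    rw [Pi.add_apply, h1, h2]
    ring

theorem HamiltonianEq.smul {u w : Γ.L2} (c : ℂ) (h : Γ.HamiltonianEq D u w) :
    Γ.HamiltonianEq D (c • u) (c • w) := by
  obtain ⟨f, f', f'', hf, hV, hu, hw⟩ := h
  refine ⟨_, _, _, fun e => (hf e).const_mul c, hV.const_mul c, fun e => ?_, fun e => ?_⟩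
  · refine (Lp.coeFn_smul c (u e)).trans ?_
    filter_upwards [hu e] with x h1
    rw [Pi.smul_apply, h1, smul_eq_mul]
  · refine (Lp.coeFn_smul c (w e)).trans ?_
    filter_upwards [hw e] with x h1
    rw [Pi.smul_apply, h1, smul_eq_mul]
    ring

/-- If `lam` is not an eigenvalue, a bounded choice of solutions of `(H - lam) u = g` is the
resolvent: uniqueness makes the choice linear. -/
theorem inResolventSet_of_exists_bound {lam : ℂ}
    (huniq : ∀ u : Γ.L2, Γ.HamiltonianEq ∅ u (lam • u) → u = 0) {C : ℝ}
    (hex : ∀ g : Γ.L2, ∃ u : Γ.L2, Γ.HamiltonianEq ∅ u (g + lam • u) ∧ ‖u‖ ≤ C * ‖g‖) :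
    Γ.InResolventSet lam := by
  have huniq' : ∀ g u u' : Γ.L2, Γ.HamiltonianEq ∅ u (g + lam • u) →
      Γ.HamiltonianEq ∅ u' (g + lam • u') → u = u' := by
    intro g u u' h h'
    rw [← sub_eq_zero]
    refine huniq _ ?_
    have := h.add (h'.smul (-1))
    convert this using 1 <;> module
  choose R hR hRb using hex
  refine ⟨LinearMap.mkContinuous
    { toFun := R
      map_add' := fun g g' => huniq' (g + g') _ _ (hR _) ?_
      map_smul' := fun c g => huniq' (c • g) _ _ (hR _) ?_ } C hRb, fun u g => ⟨fun h => ?_, ?_⟩⟩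
  · convert (hR g).add (hR g') using 1
    module
  · have := (hR g).smul c
    rw [smul_add, smul_comm c lam] at this
    exact this
  · exact huniq' g _ _ h (hR g)
  · rintro rfl
    exact hR g

theorem exists_particular_bound (k ℓ : ℝ) : ∃ C : ℝ, 0 ≤ C ∧
    ∀ g : Lp ℂ 2 (volume.restrict (Set.Ioc 0 ℓ)), ∃ p p' : ℝ → ℂ,
      IsH2 ℓ p p' (fun x => -(g x + (k : ℂ) ^ 2 * p x)) ∧ p 0 = 0 ∧ p' 0 = 0 ∧
      ∀ x ∈ Set.Icc 0 ℓ, ‖p x‖ ≤ C * ‖g‖ ∧ ‖p' x‖ ≤ C * ‖g‖ := by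
  obtain ⟨K, hK, hKb⟩ := integral_norm_Lp_two_le ℓ
  refine ⟨max (|ℓ| + |k| * ℓ ^ 2) (1 + k ^ 2 * ℓ ^ 2) * K, by positivity, fun g => ?_⟩
  obtain ⟨p, p', hp, h0, h0', hb, hb'⟩ := exists_isH2_particular (k := k) (Lp.memLp g)
  refine ⟨p, p', hp, h0, h0', fun x hx => ⟨(hb x hx).trans ?_, (hb' x hx).trans ?_⟩⟩
  · rw [mul_assoc]
    exact mul_le_mul ((add_le_add (le_abs_self ℓ) le_rfl).trans (le_max_left _ _)) (hKb g)
      (by positivity) (by positivity)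
  · rw [mul_assoc]
    exact mul_le_mul (le_max_right _ _) (hKb g) (by positivity) (by positivity)

/-- The linear system for the amplitudes `a` and the vertex values `φ` of a superposition of plane
waves: continuity at the edge ends, and the `δ`-type conditions with the coefficients `p` and `q`
of `exists_deltaCondition_iff`. -/
noncomputable def boundaryMap (Γ : QuantumGraph V E) (k : ℝ) (p q : V → ℂ) :
    ((E × Bool → ℂ) × (V → ℂ)) →ₗ[ℂ] (E × Bool → ℂ) × (V → ℂ) where
  toFun x := (fun h => Γ.endValue (Γ.graphWave k x.1) h - x.2 (Γ.endpt h.1 h.2),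
    fun v => p v * x.2 v +
      q v * ∑ h : E × Bool with Γ.endpt h.1 h.2 = v, Γ.endDeriv (Γ.graphWaveDeriv k x.1) h)
  map_add' x y := by
    simp only [endValue_graphWave, endDeriv_graphWaveDeriv]
    ext i
    · simp only [Prod.fst_add, Prod.snd_add, Pi.add_apply]
      ring
    · simp only [Prod.fst_add, Prod.snd_add, Pi.add_apply, Finset.mul_sum]
      rw [add_add_add_comm, ← Finset.sum_add_distrib, mul_add]
      congr 1
      exact Finset.sum_congr rfl fun h _ => by ring
  map_smul' c x := by
    simp only [endValue_graphWave, endDeriv_graphWaveDeriv]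
    ext i
    · simp only [Prod.smul_fst, Prod.smul_snd, Pi.smul_apply, smul_eq_mul, RingHom.id_apply]
      ring
    · simp only [Prod.smul_fst, Prod.smul_snd, Pi.smul_apply, smul_eq_mul, RingHom.id_apply,
        mul_add, Finset.mul_sum]
      congr 1
      · ring
      · exact Finset.sum_congr rfl fun h _ => by ring

theorem norm_wave_le (k ℓ : ℝ) (a b : ℂ) (x : ℝ) : ‖wave k ℓ a b x‖ ≤ ‖a‖ + ‖b‖ := by
  refine (norm_add_le _ _).trans (add_le_add ?_ ?_) <;>
  · rw [norm_mul, Complex.norm_exp]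
    simp

theorem norm_le_sum_norm {β : E → Type*} [∀ e, NormedAddCommGroup (β e)] (u : PiLp 2 β) :
    ‖u‖ ≤ ∑ e, ‖u e‖ := by
  rw [PiLp.norm_eq_of_L2]
  exact Real.sqrt_le_iff.2 ⟨by positivity,
    Finset.sum_sq_le_sq_sum_of_nonneg fun _ _ => norm_nonneg _⟩

/-- If no superposition of plane waves satisfies the vertex conditions, then the square system
`boundaryMap` is invertible. A particular solution on each edge, corrected by the plane waves that
restore the vertex conditions, solves `(H - k²) u = g`, and all steps are bounded in `g`. -/
theorem inResolventSet_of_forall_wave [Fintype V] [Nonempty E] (hΓ : Γ.Connected) (hk : k ≠ 0)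
    (h0 : ∀ a, Γ.VertexConditions ∅ (Γ.graphWave k a) (Γ.graphWaveDeriv k a) → a = 0) :
    Γ.InResolventSet ((k : ℂ) ^ 2) := by
  choose p q hq hpq using Γ.exists_deltaCondition_iff
  have hker : Function.Injective (Γ.boundaryMap k p q) := by
    rw [← LinearMap.ker_eq_bot, LinearMap.ker_eq_bot']
    rintro ⟨a, φ⟩ h
    have h1 : ∀ i : E × Bool, Γ.endValue (Γ.graphWave k a) i = φ (Γ.endpt i.1 i.2) := fun i =>
      sub_eq_zero.1 (congrFun (congrArg Prod.fst h) i)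
    have h2 := fun v => congrFun (congrArg Prod.snd h) v
    have ha : a = 0 := h0 a ⟨φ, h1, fun v => (hpq v _ _).2 (h2 v), by simp⟩
    subst ha
    ext i
    · rfl
    · obtain ⟨j, rfl⟩ := Γ.exists_endpt_eq hΓ i
      refine (h1 j).symm.trans ?_
      rw [endValue_graphWave]
      simp
  set N := (LinearEquiv.ofInjectiveEndo _ hker).symm with hN
  have hNs : ∀ y, Γ.boundaryMap k p q (N y) = y := fun y =>
    (LinearEquiv.ofInjectiveEndo _ hker).apply_symm_apply y
  set K := ‖LinearMap.toContinuousLinearMap N.toLinearMap‖ with hK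
  have hNb : ∀ y, ‖N y‖ ≤ K * ‖y‖ := fun y =>
    (LinearMap.toContinuousLinearMap N.toLinearMap).le_opNorm y
  choose C hC0 hC using fun e => exists_particular_bound k (Γ.length e)
  set B := ∑ e, C e with hB
  have hCB : ∀ e, C e ≤ B := fun e => Finset.single_le_sum (fun e _ => hC0 e) (Finset.mem_univ e)
  have hB0 : 0 ≤ B := Finset.sum_nonneg fun e _ => hC0 e
  set n : ℝ := (Fintype.card (E × Bool) : ℝ) with hn
  set A := B + 2 * (K * ((1 + n) * B)) with hA
  refine inResolventSet_of_exists_bound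
    (C := ∑ e, measureUnivNNReal (volume.restrict (Set.Ioc 0 (Γ.length e))) ^
      (2 : ENNReal).toReal⁻¹ * A) ?_ fun g => ?_
  · intro u hu
    by_contra hne
    obtain ⟨a, ha, hV⟩ := (exists_hamiltonianEq_smul_iff hk).1 ⟨u, hne, hu⟩
    exact ha (h0 a hV)
  choose r r' hr hr0 hr0' hrb using fun e => hC e (g e)
  have hrB : ∀ e, ∀ x ∈ Set.Icc 0 (Γ.length e), ‖r e x‖ ≤ B * ‖g‖ ∧ ‖r' e x‖ ≤ B * ‖g‖ := by
    intro e x hx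
    have : C e * ‖g e‖ ≤ B * ‖g‖ :=
      mul_le_mul (hCB e) (PiLp.norm_apply_le g e) (norm_nonneg _) hB0
    exact ⟨(hrb e x hx).1.trans this, (hrb e x hx).2.trans this⟩
  have hl : ∀ e, (0 : ℝ) ∈ Set.Icc 0 (Γ.length e) := fun e => ⟨le_rfl, (Γ.length_pos e).le⟩
  have hr' : ∀ e, Γ.length e ∈ Set.Icc 0 (Γ.length e) := fun e => ⟨(Γ.length_pos e).le, le_rfl⟩
  have hval : ∀ h, ‖Γ.endValue r h‖ ≤ B * ‖g‖ := by
    intro h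
    rw [endValue]
    split_ifs
    · exact (hrB _ _ (hr' _)).1
    · exact (hrB _ _ (hl _)).1
  have hder : ∀ h, ‖Γ.endDeriv r' h‖ ≤ B * ‖g‖ := by
    intro h
    rw [endDeriv]
    split_ifs
    · rw [norm_neg]
      exact (hrB _ _ (hr' _)).2
    · exact (hrB _ _ (hl _)).2
  -- The plane waves have to compensate the boundary data of the particular solution `r`.
  set y : (E × Bool → ℂ) × (V → ℂ) := (fun h => -Γ.endValue r h,
    fun v => -(q v * ∑ h : E × Bool with Γ.endpt h.1 h.2 = v, Γ.endDeriv r' h)) with hy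
  have hn0 : 0 ≤ n := Nat.cast_nonneg _
  have hBg : 0 ≤ B * ‖g‖ := by positivity
  have hyb : ‖y‖ ≤ (1 + n) * B * ‖g‖ := by
    refine norm_prod_le_iff.2 ⟨?_, ?_⟩ <;>
    refine (pi_norm_le_iff_of_nonneg (by positivity)).2 fun i => ?_
    · simp only [hy, norm_neg]
      refine (hval i).trans ?_
      rw [mul_assoc]
      exact le_mul_of_one_le_left hBg (by linarith)
    · simp only [hy, norm_neg, norm_mul]
      calc _ ≤ 1 * ∑ h : E × Bool with Γ.endpt h.1 h.2 = i, B * ‖g‖ :=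
            mul_le_mul (hq i) ((norm_sum_le _ _).trans (Finset.sum_le_sum fun h _ => hder h))
              (norm_nonneg _) zero_le_one
        _ ≤ ∑ h : E × Bool, B * ‖g‖ := by
            rw [one_mul]
            exact Finset.sum_le_sum_of_subset_of_nonneg (Finset.filter_subset _ _)
              fun _ _ _ => hBg
        _ = n * (B * ‖g‖) := by rw [Finset.sum_const, nsmul_eq_mul, hn, Finset.card_univ]
        _ ≤ (1 + n) * B * ‖g‖ := by rw [mul_assoc]; gcongr; linarith
  set a := (N y).1 with ha
  set φ := (N y).2 with hφ
  have hab : ∀ h, ‖a h‖ ≤ K * ((1 + n) * B) * ‖g‖ := by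
    intro h
    calc ‖a h‖ ≤ ‖a‖ := norm_le_pi_norm a h
      _ ≤ ‖N y‖ := norm_fst_le _
      _ ≤ K * ‖y‖ := hNb y
      _ ≤ K * ((1 + n) * B * ‖g‖) := by gcongr
      _ = _ := by ring
  have hT := hNs y
  have hT1 : ∀ h : E × Bool,
      Γ.endValue (Γ.graphWave k a) h - φ (Γ.endpt h.1 h.2) = -Γ.endValue r h := fun h =>
    congrFun (congrArg Prod.fst hT) h
  have hT2 : ∀ v, p v * φ v +
      q v * ∑ h : E × Bool with Γ.endpt h.1 h.2 = v, Γ.endDeriv (Γ.graphWaveDeriv k a) h =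
        -(q v * ∑ h : E × Bool with Γ.endpt h.1 h.2 = v, Γ.endDeriv r' h) := fun v =>
    congrFun (congrArg Prod.snd hT) v
  have hH : ∀ e, IsH2 (Γ.length e) (fun x => r e x + Γ.graphWave k a e x)
      (fun x => r' e x + Γ.graphWaveDeriv k a e x)
      (fun x => -(g e x + (k : ℂ) ^ 2 * r e x) + -((k : ℂ) ^ 2 * Γ.graphWave k a e x)) :=
    fun e => (hr e).add (isH2_wave k _ _ _)
  have hu : ∀ e, (hH e).memLp_self.toLp _ =ᵐ[volume.restrict (Set.Ioc 0 (Γ.length e))]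
      fun x => r e x + Γ.graphWave k a e x := fun e => MemLp.coeFn_toLp _
  refine ⟨WithLp.toLp 2 fun e => (hH e).memLp_self.toLp _, ⟨_, _, _, hH, ⟨φ, ?_, ?_, by simp⟩, hu,
    fun e => ?_⟩, ?_⟩
  · intro h
    rw [endValue_add]
    linear_combination hT1 h
  · intro v
    rw [hpq]
    simp only [endDeriv_add, Finset.sum_add_distrib]
    linear_combination hT2 v
  · refine (Lp.coeFn_add (g e) (((k : ℂ) ^ 2) • (hH e).memLp_self.toLp _)).trans ?_
    filter_upwards [hu e, Lp.coeFn_smul ((k : ℂ) ^ 2) ((hH e).memLp_self.toLp _)] with x h1 h2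
    rw [Pi.add_apply, h2, Pi.smul_apply, h1, smul_eq_mul]
    ring
  · refine (norm_le_sum_norm _).trans ?_
    rw [Finset.sum_mul]
    refine Finset.sum_le_sum fun e _ => ?_
    rw [mul_assoc]
    refine Lp.norm_le_of_ae_bound (by positivity) ?_
    filter_upwards [hu e, ae_restrict_mem measurableSet_Ioc] with x h1 hx
    change ‖(hH e).memLp_self.toLp _ x‖ ≤ _
    rw [h1]
    calc _ ≤ ‖r e x‖ + ‖Γ.graphWave k a e x‖ := norm_add_le _ _
      _ ≤ B * ‖g‖ + (K * ((1 + n) * B) * ‖g‖ + K * ((1 + n) * B) * ‖g‖) :=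
        add_le_add (hrB e x (Set.Ioc_subset_Icc_self hx)).1
          ((norm_wave_le _ _ _ _ _).trans (add_le_add (hab _) (hab _)))
      _ = A * ‖g‖ := by rw [hA]; ring

/-- At nonzero real `k` the spectral parameter `k²` is in the spectrum if and only if it is an
eigenvalue. -/
theorem sq_mem_spectrum_iff [Fintype V] [Nonempty E] (hΓ : Γ.Connected) (hk : k ≠ 0) :
    (k : ℂ) ^ 2 ∈ Γ.spectrum ↔
      ∃ a ≠ 0, Γ.VertexConditions ∅ (Γ.graphWave k a) (Γ.graphWaveDeriv k a) := by
  constructor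
  · intro h
    by_contra hne
    push Not at hne
    exact h (inResolventSet_of_forall_wave hΓ hk fun a ha => by_contra fun h0 => hne a h0 ha)
  · intro h
    obtain ⟨u, hu, hH⟩ := (exists_hamiltonianEq_smul_iff hk).2 h
    rintro ⟨R, hR⟩
    refine hu ?_
    have := (hR u 0).1 (by rwa [zero_add])
    rwa [map_zero] at this

end Resolvent

/-! ### Inside–outside duality -/

theorem existsUnique_isScatteringMatrix {V E : Type*} [DecidableEq V] [Fintype E] [DecidableEq E]
    [Nonempty E] (Γ : QuantumGraph V E) (hΓ : Γ.Connected) (M : Finset V) (k : ℝ) :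
    ∃! S, Γ.IsScatteringMatrix M k S := by
  have hQ := Γ.evolution_unitary M k (Γ.extDegree_pos M hΓ)
  obtain ⟨C, hC⟩ := Matrix.exists_one_sub_toBlocks₂₂_mul_eq hQ
  refine ⟨_, ⟨C, hC, rfl⟩, ?_⟩
  rintro _ ⟨C', hC', rfl⟩
  exact congrArg (Γ.matR M k + ·) (Matrix.toBlocks₁₂_mul_eq_of_mul_eq hQ (hC'.trans hC.symm))

theorem det_one_sub_evolution_eq_zero_iff_isScatteringMatrix {V E : Type*} [DecidableEq V]
    [Fintype E] [DecidableEq E] [Nonempty E] (Γ : QuantumGraph V E) (hΓ : Γ.Connected)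
    (M : Finset V) (k : ℝ) :
    (1 - Γ.evolution M k).det = 0 ↔
      (1 - Γ.matU M k).det = 0 ∨ ∃ S, Γ.IsScatteringMatrix M k S ∧ (1 - S).det = 0 := by
  have hQ := Γ.evolution_unitary M k (Γ.extDegree_pos M hΓ)
  constructor
  · intro h
    obtain ⟨C, hC⟩ := Matrix.exists_one_sub_toBlocks₂₂_mul_eq hQ
    exact ((Matrix.det_one_sub_eq_zero_iff_toBlocks hQ hC).1 h).imp_right
      fun h => ⟨_, ⟨C, hC, rfl⟩, h⟩
  · rintro (h | ⟨_, ⟨C, hC, rfl⟩, h⟩)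
    · obtain ⟨C, hC⟩ := Matrix.exists_one_sub_toBlocks₂₂_mul_eq hQ
      exact (Matrix.det_one_sub_eq_zero_iff_toBlocks hQ hC).2 (Or.inl h)
    · exact (Matrix.det_one_sub_eq_zero_iff_toBlocks hQ hC).2 (Or.inr h)

end QuantumGraph

theorem mainTheorem7 {V E : Type*} [Fintype V] [DecidableEq V] [Fintype E] [DecidableEq E]
    [Nonempty E] (Γ : QuantumGraph V E) (hΓ : Γ.Connected) (M : Finset V) :
    (∀ k : ℝ, k ≠ 0 → ∃! S, Γ.IsScatteringMatrix M k S) ∧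
    {k : ℝ | k ≠ 0 ∧ (k : ℂ) ^ 2 ∈ Γ.spectrum} =
      Γ.Delta M ∪ {k : ℝ | k ≠ 0 ∧ ∃ S, Γ.IsScatteringMatrix M k S ∧ (1 - S).det = 0} ∧
    Γ.Delta M = {k : ℝ | k ≠ 0 ∧ (k : ℂ) ^ 2 ∈ Γ.starSpectrum M} := by
  refine ⟨fun k _ => Γ.existsUnique_isScatteringMatrix hΓ M k, ?_, ?_⟩
  · ext k
    have h : k ≠ 0 → ((k : ℂ) ^ 2 ∈ Γ.spectrum ↔ (1 - Γ.matU M k).det = 0 ∨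
        ∃ S, Γ.IsScatteringMatrix M k S ∧ (1 - S).det = 0) := fun hk => by
      rw [QuantumGraph.sq_mem_spectrum_iff hΓ hk,
        ← Γ.det_one_sub_evolution_eq_zero_iff k M hΓ hk,
        Γ.det_one_sub_evolution_eq_zero_iff_isScatteringMatrix hΓ M k]
    simp only [QuantumGraph.Delta, Set.mem_union, Set.mem_ofPred_eq, ← and_or_left]
    exact and_congr_right h
  · ext k
    refine and_congr_right fun hk => ?_
    rw [Γ.det_one_sub_matU_eq_zero_iff k M hΓ hk]
    exact (QuantumGraph.exists_hamiltonianEq_smul_iff hk).symm
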